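/- Let $\log$ denote the base-2 logarithm. **Setting.** There are $K\ge 1$ arms. In round $t=1,2,\dots$ there is a reward vector $X(t)=(X_1(t),\dots,X_K(t))\in[0,1]^K$; the learner pulls an arm $J_t$ and observes only $X_{J_t}(t)$. **Hybrid-UCB with privacy parameter $\epsilon>0$.** In rounds $1,\dots,K$ every arm is pulled once. The observations of an arm $j$, in the order of its pulls, are split into consecutive blocks $0,1,2,\dots$, block $s$ having size $2^s$. When arm $j$ has $n\ge1$ observations, let $r=\lfloor\log(n+1)\rfloor$, so that blocks $0,\dots,r-1$ are full and $c=n-(2^r-1)<2^r$ observations lie in block $r$. Two mechanisms, each run with parameter $\epsilon/2$, are used. (i) Each full block $s\le r-1$ contributes the sum of its observations plus one noise variable $Z_j^{(s)}\sim\mathrm{Lap}(1/(0.5\epsilon))$. (ii) The $c$ observations of the open block $r$ are the leftmost leaves of a complete binary tree with $2^r$ leaves, each node $v$ of which carries a noise variable $Y_{j}^{(r,v)}\sim\mathrm{Lap}(r/(0.5\epsilon))$; the contribution is the sum of these $c$ observations plus the noise of the at most $r$ nodes which, according to the binary expansion of $c$, partition the first $c$ leaves (one node with $2^k$ leaves for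 each binary digit $2^k$ of $c$, larger nodes to the left). All noise variables are independent and each is drawn once. Dividing the sum of all contributions by $n$ gives the private empirical mean $\widetilde\mu_{j,n}$. In every round $t>K$, with $O_j$ the number of pulls of $j$ before round $t$, the learner pulls an arm $J_t$ (ties broken by an arbitrary fixed rule) that maximises $$\overline\mu_j(t)=\widetilde\mu_{j,O_j}+\sqrt{\frac{3\log t}{O_j}}+\frac{6\sqrt8\,\log(t)\,\lfloor\log(O_j+1)\rfloor}{O_j\,\epsilon}.$$ **Theorem.** (Privacy) For every $T$, Hybrid-UCB is $\epsilon$-differentially private: for any two sequences $S,S'$ of reward vectors in $[0,1]^K$ that differ in at most one reward vector, and any set $\mathcal D$ of decision sequences $(J_1,\dots,J_T)$, the probability that Hybrid-UCB run on $S$ makes decisions in $\mathcal D$ is at most $e^{\epsilon}$ times the probability that Hybrid-UCB run on $S'$ does. (Regret) There is an absolute constant $C>0$ such that the following holds for all $K\ge1$, $\epsilon>0$, $T\ge 2$ and every distribution on $[0,1]^K$. Let the reward vectors $X(1),X(2),\dots$ be i.i.d. from this distribution and independent of the noise, let $\mu_j=\mathbb E[X_j(t)]$ and $\Delta_j=\max_k\mu_k-\mu_j$.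 Then the regret $\mathcal R(T)=\max_j\mathbb E\big[\sum_{t=1}^T X_j(t)-\sum_{t=1}^T X_{J_t}(t)\big]$ of Hybrid-UCB satisfies $$\mathcal R(T)\le C\sum_{j:\,\Delta_j>0}\max\left\{\frac{\log T}{\Delta_j},\ \frac{\log T}{\epsilon}\log\left(\frac{\log T}{\epsilon\,\Delta_j}\right)\right\}.$$ -/

import Mathlib

open MeasureTheory

/-! ### The Laplace distribution -/

/-- Density of the Laplace distribution centred at `0` with scale `b > 0`. -/
noncomputable def laplaceDensity (b x : ℝ) : ℝ := Real.exp (-(|x| / b)) / (2 * b)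

/-- The Laplace distribution `Lap(b)` centred at `0` with scale `b`. For `b ≤ 0` it is, by
convention, the Dirac mass at `0` (as Mathlib does for Gaussian measures of variance `0`);
only scales `b > 0` matter for the algorithm. -/
noncomputable def laplace (b : ℝ) : Measure ℝ :=
  if 0 < b then volume.withDensity (fun x => ENNReal.ofReal (laplaceDensity b x))
  else Measure.dirac 0

lemma integral_laplaceDensity {b : ℝ} (hb : 0 < b) : ∫ x, laplaceDensity b x = 1 := by
  have h := integral_comp_abs (f := fun x : ℝ => laplaceDensity b x)
  have h' : (fun x : ℝ => laplaceDensity b |x|) = laplaceDensity b := by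
    funext x; simp [laplaceDensity]
  rw [h'] at h
  have e : ∫ x in Set.Ioi (0 : ℝ), laplaceDensity b x
      = ∫ x in Set.Ioi (0 : ℝ), (fun y : ℝ => Real.exp (-y) / (2 * b)) (b⁻¹ * x) := by
    refine setIntegral_congr_fun measurableSet_Ioi ?_
    intro x hx
    simp only [laplaceDensity, abs_of_pos (Set.mem_Ioi.mp hx), div_eq_inv_mul]
  have e2 := integral_comp_mul_left_Ioi (fun y : ℝ => Real.exp (-y) / (2 * b)) 0
    (inv_pos.mpr hb)
  rw [h, e, e2, mul_zero, integral_div, integral_exp_neg_Ioi_zero]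
  simp
  field_simp

instance (b : ℝ) : IsProbabilityMeasure (laplace b) := by
  unfold laplace
  split_ifs with hb
  · refine ⟨?_⟩
    have hi : Integrable (laplaceDensity b) := by
      by_contra hn
      have h1 := integral_laplaceDensity hb
      rw [integral_undef hn] at h1
      exact zero_ne_one h1
    rw [withDensity_apply _ MeasurableSet.univ, Measure.restrict_univ,
      ← ofReal_integral_eq_lintegral_ofReal hi
        (Filter.Eventually.of_forall fun x => by unfold laplaceDensity; positivity),
      integral_laplaceDensity hb, ENNReal.ofReal_one]
  · infer_instance

/-! ### The Hybrid-UCB algorithm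

Arms are the elements of `Fin K`. Rounds are indexed from `0`: the index `t` stands for round
`t + 1`. The observations of one arm are numbered `0, 1, 2, …` in the order of the pulls.
They are stored in consecutive blocks: block `s` (for `s = 0, 1, …`) has size `2 ^ s` and holds
the observations with numbers in `[2 ^ s - 1, 2 ^ (s + 1) - 1)`. Block `s` is kept
both in an array and (for `s ≥ 1`) in the leaves of a complete binary tree with `2 ^ s` leaves.
In a tree, the node of level `k` and position `p` covers the leaves `p * 2 ^ k, …,
(p + 1) * 2 ^ k - 1`. -/

/-- Labels of the noise variables: one for each array and one for each node of each tree. -/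
inductive NoiseIndex (K : ℕ) where
  | array (j : Fin K) (s : ℕ) : NoiseIndex K
  | node (j : Fin K) (s level pos : ℕ) : NoiseIndex K

/-- Scales of the Laplace noise: each of the two mechanisms is run with privacy parameter
`0.5 * ε`; every array gets noise of scale `1 / (0.5 ε)`, every node of the tree with
`2 ^ s` leaves gets noise of scale `log₂ (2 ^ s) / (0.5 ε) = s / (0.5 ε)`. -/
noncomputable def noiseScale {K : ℕ} (ε : ℝ) : NoiseIndex K → ℝ
  | .array _ _ => 1 / (0.5 * ε)
  | .node _ s _ _ => s / (0.5 * ε)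

/-- Joint law of the (independent) noise variables. -/
noncomputable def noiseMeasure (K : ℕ) (ε : ℝ) : Measure (NoiseIndex K → ℝ) :=
  Measure.infinitePi (fun i => laplace (noiseScale ε i))

/-- `⌊log₂ (n + 1)⌋`: the number of blocks which are full once an arm has `n` observations,
which is also the index of the block that takes the next observation. -/
def blockIndex (n : ℕ) : ℕ := Nat.log 2 (n + 1)

/-- The number of observations in the current, not yet full, block. -/
def openCount (n : ℕ) : ℕ := n - (2 ^ blockIndex n - 1)

/-- The nodes (level, position) whose p-sums the binary mechanism adds up in order
to sum the first `c` leaves: one node of level `k` for each nonzero binary digit `2 ^ k` of `c`,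
covering the leaves from `(c / 2 ^ k - 1) * 2 ^ k` to `(c / 2 ^ k) * 2 ^ k - 1`. -/
def pSumNodes (c : ℕ) : Finset (ℕ × ℕ) :=
  ((Finset.range c).filter (fun k => c.testBit k)).image (fun k => (k, c / 2 ^ k - 1))

/-- The noisy sum of all observations in the full arrays `0, …, r - 1` of arm `j`. -/
def noisyArraySum {K : ℕ} (z : NoiseIndex K → ℝ) (j : Fin K) (r : ℕ) (obs : ℕ → ℝ) : ℝ :=
  ∑ s ∈ Finset.range r,
    (∑ i ∈ Finset.Ico (2 ^ s - 1) (2 ^ (s + 1) - 1), obs i + z (.array j s))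

/-- The noisy sum of the `c` observations in tree `r` of arm `j`. -/
def noisyTreeSum {K : ℕ} (z : NoiseIndex K → ℝ) (j : Fin K) (r c : ℕ) (obs : ℕ → ℝ) : ℝ :=
  ∑ i ∈ Finset.range c, obs (2 ^ r - 1 + i) + ∑ v ∈ pSumNodes c, z (.node j r v.1 v.2)

/-- The differentially private empirical mean of arm `j` from its first `n` observations. -/
noncomputable def privateMean {K : ℕ} (z : NoiseIndex K → ℝ) (j : Fin K) (n : ℕ)
    (obs : ℕ → ℝ) : ℝ :=
  (noisyArraySum z j (blockIndex n) obs
    + noisyTreeSum z j (blockIndex n) (openCount n) obs) / n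

/-- The upper confidence bound of arm `j` in round number `t` (counted from `1`). -/
noncomputable def ucbIndex {K : ℕ} (ε : ℝ) (z : NoiseIndex K → ℝ) (t : ℕ) (j : Fin K) (n : ℕ)
    (obs : ℕ → ℝ) : ℝ :=
  privateMean z j n obs + Real.sqrt (3 * Real.logb 2 t / n)
    + 6 * Real.sqrt 8 * Real.logb 2 t * (⌊Real.logb 2 ((n : ℝ) + 1)⌋ : ℝ) / (n * ε)

/-- What the learner remembers: for each arm the number of its observations, and their values
(the values with number at least the count are irrelevant and `0`). -/
abbrev BanditState (K : ℕ) := Fin K → ℕ × (ℕ → ℝ)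

/-- The arm pulled in the round with index `t` (round number `t + 1`): in the first `K` rounds
every arm is pulled once, afterwards an arm with maximal upper confidence bound is pulled, where
`sel` picks a maximiser. -/
noncomputable def pullArm {K : ℕ} (sel : (Fin K → ℝ) → Fin K) (ε : ℝ) (z : NoiseIndex K → ℝ)
    (t : ℕ) (st : BanditState K) : Fin K :=
  if h : t < K then ⟨t, h⟩
  else sel (fun j => ucbIndex ε z (t + 1) j (st j).1 (st j).2)

/-- Append the observation `y` to the observations of arm `j`. -/
def insertObs {K : ℕ} (st : BanditState K) (j : Fin K) (y : ℝ) : BanditState K :=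
  Function.update st j ((st j).1 + 1, Function.update (st j).2 (st j).1 y)

/-- The state after the first `t` rounds, on the reward vectors `x` and the noise `z`. -/
noncomputable def hybridState {K : ℕ} (sel : (Fin K → ℝ) → Fin K) (ε : ℝ)
    (x : ℕ → Fin K → ℝ) (z : NoiseIndex K → ℝ) : ℕ → BanditState K
  | 0 => fun _ => (0, fun _ => 0)
  | t + 1 =>
    let st := hybridState sel ε x z t
    let j := pullArm sel ε z t st
    insertObs st j (x t j)

/-- Hybrid-UCB: the arm pulled in the round with index `t`. -/
noncomputable def hybridUCB {K : ℕ} (sel : (Fin K → ℝ) → Fin K) (ε : ℝ)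
    (x : ℕ → Fin K → ℝ) (z : NoiseIndex K → ℝ) (t : ℕ) : Fin K :=
  pullArm sel ε z t (hybridState sel ε x z t)

/-- A (measurable) rule that selects a maximiser, i.e. a way to break ties. -/
def IsArgmaxRule {K : ℕ} (sel : (Fin K → ℝ) → Fin K) : Prop :=
  Measurable sel ∧ ∀ (u : Fin K → ℝ) (j : Fin K), u j ≤ u (sel u)

/-! ### Differential privacy -/

/-- All reward vectors have entries in `[0, 1]`. -/
def IsRewardSeq {K : ℕ} (x : ℕ → Fin K → ℝ) : Prop := ∀ t j, x t j ∈ Set.Icc (0 : ℝ) 1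

/-- The two sequences differ in at most one reward vector. -/
def AreNeighbours {K : ℕ} (x x' : ℕ → Fin K → ℝ) : Prop := ∃ s, ∀ t, t ≠ s → x t = x' t

/-- `ε`-differential privacy over `T` rounds of a randomised decision algorithm, which pulls the
arm `alg x z t` in the round with index `t` on rewards `x` and randomness `z ∼ P`. -/
def IsDifferentiallyPrivate {K : ℕ} {Z : Type*} [MeasurableSpace Z] (P : Measure Z)
    (alg : (ℕ → Fin K → ℝ) → Z → ℕ → Fin K) (ε : ℝ) (T : ℕ) : Prop :=
  ∀ x x' : ℕ → Fin K → ℝ, IsRewardSeq x → IsRewardSeq x' → AreNeighbours x x' →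
    ∀ D : Set (Fin T → Fin K),
      P {z | (fun t : Fin T => alg x z t) ∈ D}
        ≤ ENNReal.ofReal (Real.exp ε) * P {z | (fun t : Fin T => alg x' z t) ∈ D}

/-! ### Stochastic bandits and regret -/

/-- The mean reward of arm `j` when reward vectors have law `ν`. -/
noncomputable def armMean {K : ℕ} (ν : Measure (Fin K → ℝ)) (j : Fin K) : ℝ := ∫ v, v j ∂ν

/-- The gap of arm `j`. -/
noncomputable def armGap {K : ℕ} (ν : Measure (Fin K → ℝ)) (j : Fin K) : ℝ :=
  (⨆ k, armMean ν k) - armMean ν j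

/-- The (pseudo-)regret over `T` rounds, `max_j 𝔼[∑ₜ X_j(t) - ∑ₜ X_{J_t}(t)]`, of the
algorithm `alg` with internal randomness of law `P`, when the reward vectors are i.i.d. over time
with law `ν` and independent of the internal randomness. -/
noncomputable def pseudoRegret {K : ℕ} {Z : Type*} [MeasurableSpace Z] (P : Measure Z)
    (alg : (ℕ → Fin K → ℝ) → Z → ℕ → Fin K) (ν : Measure (Fin K → ℝ)) [IsProbabilityMeasure ν]
    (T : ℕ) : ℝ :=
  ⨆ j : Fin K, ∫ ω, (∑ t ∈ Finset.range T, ω.1 t j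
      - ∑ t ∈ Finset.range T, ω.1 t (alg ω.1 ω.2 t))
    ∂((Measure.infinitePi (fun _ : ℕ => ν)).prod P)

/-! Privacy is a coupling by translation of the noise. Fix a decision sequence `d`. If the reward
vectors differ in round `τ` only, the sole observation that can change is observation `i` of arm `j
= d τ`, and both `j` and `i` are read off from `d`. Translate by `δ = x τ j - x' τ j` the noise of
the block of `i` and of every node of level below `r` above its leaf, where `r` is the index of this
block. These variables enter a private mean only when the observation does, and then exactly one of
them occurs, so both runs make the same decisions (`hybridUCB_shift`). Translating `Lap(b)` by `δ`
costs a factor `exp (|δ| / b)`. One array of scale `2 / ε` and `r` nodes of scale `2 r / ε` cost at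
most `exp ε` together (`sum_affectedNoise_le`, `map_shift_infinitePi_laplace_le`). Summing over `d ∈
D` gives the general event.

The regret bound is a UCB argument with two sources of error. Sampling error is controlled by an
exponential supermartingale, since observations are collected adaptively (`rewardDeviation_tail`).
The total noise is a sum of at most `2 r` independent Laplace variables, `r` now being the block
index of the number of observations, and a Chernoff bound applies (`noiseSum_tail`). Outside events
of summable probability, a pulled suboptimal arm has gap below twice its confidence width
(`mean_lt_of_pull`). That fails once the arm has of order `gapTerm / Δ` observations
(`two_mul_confidenceWidth_le`), so its contribution to the regret is of order `gapTerm`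
(`expected_pulls_le`). Since decisions are independent of the current reward vector, the regret is
bounded by the sum of these contributions (`integral_regret_le`). -/

/-! ### Laplace distributions: translation and moment generating function. -/

lemma laplace_of_pos {b : ℝ} (hb : 0 < b) :
    laplace b = volume.withDensity (fun x => ENNReal.ofReal (laplaceDensity b x)) :=
  if_pos hb

lemma laplace_zero : laplace 0 = Measure.dirac 0 := if_neg (lt_irrefl 0)

lemma laplaceDensity_nonneg {b : ℝ} (hb : 0 < b) (x : ℝ) : 0 ≤ laplaceDensity b x := by
  unfold laplaceDensity; positivity

@[fun_prop]
lemma measurable_laplaceDensity (b : ℝ) : Measurable (laplaceDensity b) := by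
  unfold laplaceDensity; fun_prop

/-- By the triangle inequality `|x| - |x - δ| ≤ |δ|`. This pointwise density ratio is the only
source of privacy. -/
lemma laplaceDensity_sub_le {b : ℝ} (hb : 0 < b) (δ x : ℝ) :
    laplaceDensity b (x - δ) ≤ Real.exp (|δ| / b) * laplaceDensity b x := by
  unfold laplaceDensity
  rw [mul_div_assoc', ← Real.exp_add]
  gcongr
  rw [← sub_eq_add_neg, ← sub_div, neg_div', div_le_div_iff_of_pos_right hb]
  have h := abs_sub_abs_le_abs_sub x (x - δ)
  rw [sub_sub_cancel] at h
  linarith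

/-- Translating the Laplace distribution changes probabilities by a bounded factor. -/
lemma map_add_laplace_le {b : ℝ} (hb : 0 < b) (δ : ℝ) :
    (laplace b).map (· + δ) ≤ ENNReal.ofReal (Real.exp (|δ| / b)) • laplace b := by
  refine Measure.le_iff.2 fun s hs => ?_
  rw [Measure.map_apply (by fun_prop) hs, laplace_of_pos hb,
    withDensity_apply _ (measurable_add_const δ hs), Measure.smul_apply, smul_eq_mul,
    withDensity_apply _ hs, ← lintegral_const_mul _ (by fun_prop)]
  have h := (measurePreserving_add_right (volume : Measure ℝ) δ).setLIntegral_comp_preimage hs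
    (f := fun x => ENNReal.ofReal (laplaceDensity b (x - δ))) (by fun_prop)
  simp only [add_sub_cancel_right] at h
  rw [h]
  refine lintegral_mono fun x => ?_
  rw [← ENNReal.ofReal_mul (Real.exp_nonneg _)]
  exact ENNReal.ofReal_le_ofReal (laplaceDensity_sub_le hb δ x)

lemma integrableOn_Ioi_exp_mul_laplaceDensity {b l : ℝ} (hb : 0 < b) (hl : l < 1 / b) :
    IntegrableOn (fun x => Real.exp (l * x) * laplaceDensity b x) (Set.Ioi 0) ∧
      ∫ x in Set.Ioi 0, Real.exp (l * x) * laplaceDensity b x = 1 / (2 * (1 - l * b)) := by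
  have hneg : l - 1 / b < 0 := by linarith
  have e : Set.EqOn (fun x => Real.exp (l * x) * laplaceDensity b x)
      (fun x => Real.exp ((l - 1 / b) * x) / (2 * b)) (Set.Ioi 0) := by
    intro x hx
    simp only [laplaceDensity, abs_of_pos (Set.mem_Ioi.mp hx)]
    rw [mul_div_assoc', ← Real.exp_add]
    congr 2; ring
  refine ⟨(integrableOn_congr_fun e measurableSet_Ioi).2
    ((integrableOn_exp_mul_Ioi hneg 0).div_const _), ?_⟩
  rw [setIntegral_congr_fun measurableSet_Ioi e, integral_div, integral_exp_mul_Ioi hneg]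
  have h1 : l * b - 1 < 0 := by
    have := mul_neg_of_neg_of_pos hneg hb
    rwa [sub_mul, one_div_mul_cancel hb.ne'] at this
  have h2 : l - 1 / b = (l * b - 1) / b := by field_simp
  have h3 : (1 - l * b) ≠ 0 := by linarith
  rw [mul_zero, Real.exp_zero, h2]
  have h4 : l * b - 1 ≠ 0 := h1.ne
  rw [show 1 - l * b = -(l * b - 1) by ring]
  field_simp

lemma integrable_exp_mul_laplaceDensity {b l : ℝ} (hb : 0 < b) (hl : |l * b| < 1) :
    Integrable (fun x => Real.exp (l * x) * laplaceDensity b x) ∧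
      ∫ x, Real.exp (l * x) * laplaceDensity b x = 1 / (1 - (l * b) ^ 2) := by
  obtain ⟨h1, h2⟩ := abs_lt.1 hl
  have hl1 : l < 1 / b := by rwa [lt_div_iff₀ hb]
  -- The density is even, so the left half-line is the right half-line with `-l` in place of `l`.
  have hl2 : -l < 1 / b := by rw [lt_div_iff₀ hb]; linarith
  obtain ⟨ip, ep⟩ := integrableOn_Ioi_exp_mul_laplaceDensity hb hl1
  obtain ⟨im, em⟩ := integrableOn_Ioi_exp_mul_laplaceDensity hb hl2
  have hsymm : ∀ x, Real.exp (-l * -x) * laplaceDensity b (-x)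
      = Real.exp (l * x) * laplaceDensity b x := by
    intro x; simp [laplaceDensity]
  have im' : IntegrableOn (fun x => Real.exp (l * x) * laplaceDensity b x) (Set.Iic 0) := by
    have := (integrableOn_Ici_iff_integrableOn_Ioi).2 im
    have h := (Measure.measurePreserving_neg (volume : Measure ℝ)).integrableOn_comp_preimage
      (MeasurableEquiv.neg ℝ).measurableEmbedding
      (f := fun x => Real.exp (-l * x) * laplaceDensity b x) (s := Set.Ici 0)
    have h' := h.2 this
    simpa [Function.comp_def, laplaceDensity] using h'
  have em' : ∫ x in Set.Iic 0, Real.exp (l * x) * laplaceDensity b x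
      = 1 / (2 * (1 - -l * b)) := by
    rw [← em, ← neg_zero, ← integral_comp_neg_Iic, neg_zero]
    simp only [hsymm]
  constructor
  · rw [← integrableOn_univ, ← Set.Iic_union_Ioi (a := (0 : ℝ))]
    exact im'.union ip
  · rw [← intervalIntegral.integral_Iic_add_Ioi im' ip, ep, em']
    have : 1 - l * b ≠ 0 := by linarith
    have : 1 + l * b ≠ 0 := by linarith
    have : 1 - (l * b) ^ 2 ≠ 0 := by
      rw [show 1 - (l * b) ^ 2 = (1 - l * b) * (1 + l * b) by ring]; positivity
    rw [show 1 - -l * b = 1 + l * b by ring,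
      show 1 - (l * b) ^ 2 = (1 - l * b) * (1 + l * b) by ring]
    field_simp
    ring

lemma integrable_exp_mul_laplace {b l : ℝ} (hb : 0 ≤ b) (hl : |l * b| < 1) :
    Integrable (fun x => Real.exp (l * x)) (laplace b) ∧
      ∫ x, Real.exp (l * x) ∂(laplace b) = 1 / (1 - (l * b) ^ 2) := by
  rcases hb.eq_or_lt with rfl | hb
  · rw [laplace_zero]
    exact ⟨integrable_dirac (by simp), by simp⟩
  · obtain ⟨h1, h2⟩ := integrable_exp_mul_laplaceDensity hb hl
    rw [laplace_of_pos hb]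
    constructor
    · rw [integrable_withDensity_iff (by fun_prop) (by simp)]
      simpa [ENNReal.toReal_ofReal (laplaceDensity_nonneg hb _)] using h1
    · rw [integral_withDensity_eq_integral_toReal_smul (by fun_prop) (by simp), ← h2]
      refine integral_congr_ae (.of_forall fun x => ?_)
      simp [ENNReal.toReal_ofReal (laplaceDensity_nonneg hb _), mul_comm]

lemma inv_one_sub_le_exp {x : ℝ} (h0 : 0 ≤ x) (h : x ≤ 1 / 2) :
    1 / (1 - x) ≤ Real.exp (2 * x) := by
  rw [div_le_iff₀ (by linarith)]
  -- `(1 + 2 x) (1 - x) = 1 + x (1 - 2 x) ≥ 1`.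
  nlinarith [Real.add_one_le_exp (2 * x)]

/-- The Laplace distribution is subexponential. -/
lemma integral_exp_mul_laplace_le {b l : ℝ} (hb : 0 ≤ b) (hl : |l * b| ≤ 1 / 2) :
    ∫ x, Real.exp (l * x) ∂(laplace b) ≤ Real.exp (2 * (l * b) ^ 2) := by
  rw [(integrable_exp_mul_laplace hb (by linarith)).2]
  refine inv_one_sub_le_exp (sq_nonneg _) ?_
  rw [← sq_abs]
  nlinarith [abs_nonneg (l * b)]

/-! ### Pull counts and the dependence of a run on past rewards. -/

section Structure

variable {K : ℕ} {sel : (Fin K → ℝ) → Fin K} {ε : ℝ}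

lemma hybridState_succ (x : ℕ → Fin K → ℝ) (z : NoiseIndex K → ℝ) (t : ℕ) :
    hybridState sel ε x z (t + 1) = insertObs (hybridState sel ε x z t)
      (hybridUCB sel ε x z t) (x t (hybridUCB sel ε x z t)) := rfl

lemma insertObs_self (st : BanditState K) (j : Fin K) (y : ℝ) :
    insertObs st j y j = ((st j).1 + 1, Function.update (st j).2 (st j).1 y) := by
  simp [insertObs]

lemma insertObs_of_ne (st : BanditState K) {j a : Fin K} (h : a ≠ j) (y : ℝ) :
    insertObs st j y a = st a := by
  simp [insertObs, h]

/-- The number of pulls of arm `a` before the round with index `t`, when `J` lists the pulls. -/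
def pullCount (J : ℕ → Fin K) (a : Fin K) (t : ℕ) : ℕ :=
  ((Finset.range t).filter (fun s => J s = a)).card

lemma pullCount_zero (J : ℕ → Fin K) (a : Fin K) : pullCount J a 0 = 0 := rfl

lemma pullCount_succ (J : ℕ → Fin K) (a : Fin K) (t : ℕ) :
    pullCount J a (t + 1) = pullCount J a t + if J t = a then 1 else 0 := by
  simp only [pullCount, Finset.range_add_one, Finset.filter_insert]
  split_ifs with h
  · rw [Finset.card_insert_of_notMem (by simp)]
  · simp

lemma pullCount_mono (J : ℕ → Fin K) (a : Fin K) : Monotone (pullCount J a) :=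
  monotone_nat_of_le_succ fun t => by rw [pullCount_succ]; exact Nat.le_add_right _ _

lemma pullCount_le (J : ℕ → Fin K) (a : Fin K) (t : ℕ) : pullCount J a t ≤ t := by
  simpa [pullCount] using Finset.card_filter_le (Finset.range t) (fun s => J s = a)

lemma pullCount_lt_of_lt {J : ℕ → Fin K} {a : Fin K} {s t : ℕ} (hs : J s = a) (h : s < t) :
    pullCount J a s < pullCount J a t := by
  refine lt_of_lt_of_le ?_ (pullCount_mono J a (Nat.succ_le_of_lt h))
  rw [Nat.succ_eq_add_one, pullCount_succ, if_pos hs]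
  exact Nat.lt_succ_self _

/-- The count increases strictly at each pull, so arm and observation number determine the round. -/
lemma eq_of_pullCount_eq {J : ℕ → Fin K} {a : Fin K} {s t : ℕ} (hs : J s = a) (ht : J t = a)
    (h : pullCount J a s = pullCount J a t) : s = t := by
  rcases lt_trichotomy s t with hst | hst | hst
  · exact absurd h (pullCount_lt_of_lt hs hst).ne
  · exact hst
  · exact absurd h (pullCount_lt_of_lt ht hst).ne'

lemma pullCount_congr {J J' : ℕ → Fin K} {t : ℕ} (h : ∀ s < t, J s = J' s) (a : Fin K) :
    pullCount J a t = pullCount J' a t := by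
  unfold pullCount
  congr 1
  exact Finset.filter_congr fun s hs => by rw [h s (Finset.mem_range.1 hs)]

lemma hybridState_fst (x : ℕ → Fin K → ℝ) (z : NoiseIndex K → ℝ) (t : ℕ) (a : Fin K) :
    (hybridState sel ε x z t a).1 = pullCount (hybridUCB sel ε x z) a t := by
  induction t with
  | zero => rfl
  | succ t ih =>
    rw [hybridState_succ, pullCount_succ, ← ih]
    split_ifs with h
    · rw [h, insertObs_self]
    · rw [insertObs_of_ne _ (Ne.symm h), add_zero]

/-- Every arm has been pulled after the first `K` rounds. -/
lemma one_le_pullCount (x : ℕ → Fin K → ℝ) (z : NoiseIndex K → ℝ) {t : ℕ} (ht : K ≤ t)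
    (a : Fin K) : 1 ≤ pullCount (hybridUCB sel ε x z) a t := by
  have h : hybridUCB sel ε x z a = a := by simp [hybridUCB, pullArm]
  have := pullCount_lt_of_lt h (a.2.trans_le ht)
  omega

/-- The state before round `t` depends on the rewards of earlier rounds only. -/
lemma hybridState_congr {x x' : ℕ → Fin K → ℝ} (z : NoiseIndex K → ℝ) {t : ℕ}
    (h : ∀ s < t, x s = x' s) : hybridState sel ε x z t = hybridState sel ε x' z t := by
  induction t with
  | zero => rfl
  | succ t ih =>
    have ih' := ih fun s hs => h s (hs.trans (Nat.lt_succ_self t))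
    rw [hybridState_succ, hybridState_succ, hybridUCB, hybridUCB, ih', h t (Nat.lt_succ_self t)]

lemma hybridUCB_congr {x x' : ℕ → Fin K → ℝ} (z : NoiseIndex K → ℝ) {t : ℕ}
    (h : ∀ s < t, x s = x' s) : hybridUCB sel ε x z t = hybridUCB sel ε x' z t := by
  rw [hybridUCB, hybridUCB, hybridState_congr z h]

end Structure

/-! ### Measurability of the run in rewards and noise. -/

section Measurability

variable {K : ℕ} {sel : (Fin K → ℝ) → Fin K} {ε : ℝ} {Ω : Type*} [MeasurableSpace Ω]

lemma measurable_ucbIndex (t : ℕ) (j : Fin K) (n : ℕ) :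
    Measurable fun p : (NoiseIndex K → ℝ) × (ℕ → ℝ) => ucbIndex ε p.1 t j n p.2 := by
  unfold ucbIndex privateMean noisyArraySum noisyTreeSum
  fun_prop

lemma Measurable.insertObs {S : Ω → BanditState K} {J : Ω → Fin K} {Y : Ω → ℝ}
    (hS : Measurable S) (hJ : Measurable J) (hY : Measurable Y) :
    Measurable fun ω => insertObs (S ω) (J ω) (Y ω) := by
  refine measurable_pi_iff.2 fun a => ?_
  -- The updated arm and position are random; a pointwise `if` turns both into measurable events.
  have e : (fun ω => _root_.insertObs (S ω) (J ω) (Y ω) a) = fun ω => if J ω = a then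
      ((S ω a).1 + 1, fun m => if m = (S ω a).1 then Y ω else (S ω a).2 m) else S ω a := by
    funext ω
    split_ifs with h
    · rw [h, insertObs_self]
      congr 1
      funext m
      simp [Function.update_apply]
    · rw [insertObs_of_ne _ (Ne.symm h)]
  rw [e]
  have hSa : Measurable fun ω => S ω a := hS.eval
  have h1 : Measurable fun ω => (S ω a).1 := measurable_fst.comp hSa
  have h2 : Measurable fun ω => (S ω a).2 := measurable_snd.comp hSa
  have h3 : Measurable fun ω => (S ω a).1 + 1 := h1.add_const 1
  have h4 : Measurable fun ω m => if m = (S ω a).1 then Y ω else (S ω a).2 m := by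
    refine measurable_pi_iff.2 fun m => ?_
    have h5 : Measurable fun ω => (S ω a).2 m := (measurable_pi_apply m).comp h2
    exact Measurable.ite (measurableSet_eq_fun measurable_const h1) hY h5
  have h6 : MeasurableSet {ω | J ω = a} := hJ (measurableSet_singleton a)
  exact Measurable.ite h6 (h3.prodMk h4) hSa

lemma Measurable.pullArm (hsel : Measurable sel) {S : Ω → BanditState K}
    {Z : Ω → NoiseIndex K → ℝ} (hS : Measurable S) (hZ : Measurable Z) (t : ℕ) :
    Measurable fun ω => pullArm sel ε (Z ω) t (S ω) := by
  unfold _root_.pullArm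
  split_ifs with h
  · exact measurable_const
  · refine hsel.comp (measurable_pi_iff.2 fun j => ?_)
    -- The random count takes countably many values, so joint measurability follows from each fixed
    -- count.
    have hf : Measurable fun p : ℕ × ((NoiseIndex K → ℝ) × (ℕ → ℝ)) =>
        ucbIndex ε p.2.1 (t + 1) j p.1 p.2.2 :=
      measurable_from_prod_countable_right fun n => measurable_ucbIndex (t + 1) j n
    have hSj : Measurable fun ω => S ω j := hS.eval
    have h1 : Measurable fun ω => (S ω j).1 := measurable_fst.comp hSj
    have h2 : Measurable fun ω => (S ω j).2 := measurable_snd.comp hSj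
    have h3 : Measurable fun ω => ((S ω j).1, (Z ω, (S ω j).2)) := h1.prodMk (hZ.prodMk h2)
    have h4 := hf.comp h3
    simpa only [Function.comp_def] using h4

lemma measurable_apply_index {Y : Ω → Fin K → ℝ} {J : Ω → Fin K} (hY : Measurable Y)
    (hJ : Measurable J) : Measurable fun ω => Y ω (J ω) := by
  have h : Measurable fun p : Fin K × (Fin K → ℝ) => p.2 p.1 :=
    measurable_from_prod_countable_right fun j => measurable_pi_apply j
  exact h.comp (hJ.prodMk hY)

lemma measurable_hybridState (hsel : Measurable sel) {X : Ω → ℕ → Fin K → ℝ}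
    {Z : Ω → NoiseIndex K → ℝ} (hX : Measurable X) (hZ : Measurable Z) (t : ℕ) :
    Measurable fun ω => hybridState sel ε (X ω) (Z ω) t := by
  induction t with
  | zero => exact measurable_const
  | succ t ih =>
    have hJ := Measurable.pullArm (ε := ε) hsel ih hZ t
    exact ih.insertObs hJ (measurable_apply_index ((measurable_pi_apply t).comp hX) hJ)

lemma measurable_hybridUCB (hsel : Measurable sel) {X : Ω → ℕ → Fin K → ℝ}
    {Z : Ω → NoiseIndex K → ℝ} (hX : Measurable X) (hZ : Measurable Z) (t : ℕ) :
    Measurable fun ω => hybridUCB sel ε (X ω) (Z ω) t :=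
  Measurable.pullArm hsel (measurable_hybridState hsel hX hZ t) hZ t

end Measurability

/-! ### Changing finitely many factors of an infinite product measure. -/

section ProductShift

variable {ι : Type*} {X : ι → Type*} [∀ i, MeasurableSpace (X i)]

lemma measurable_update_prod [DecidableEq ι] (i : ι) :
    Measurable fun p : (∀ k, X k) × X i => Function.update p.1 i p.2 := by
  refine measurable_pi_iff.2 fun k => ?_
  by_cases h : k = i
  · subst h; simpa using measurable_snd
  · simp only [Function.update_of_ne h]; fun_prop

/-- Resampling one coordinate of a product measure changes the corresponding factor. -/
lemma map_update_infinitePi_prod [DecidableEq ι] (μ : ∀ i, Measure (X i))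
    [∀ i, IsProbabilityMeasure (μ i)] (i : ι) (ρ : Measure (X i)) [IsProbabilityMeasure ρ]
    {μ' : ∀ i, Measure (X i)} [∀ k, IsProbabilityMeasure (μ' k)]
    (hμ' : μ' = Function.update μ i ρ) :
    ((Measure.infinitePi μ).prod ρ).map (fun p => Function.update p.1 i p.2)
      = Measure.infinitePi μ' := by
  subst hμ'
  have hm := measurable_update_prod (X := X) i
  refine Measure.eq_infinitePi _ fun s t ht => ?_
  have hs : MeasurableSet (Set.pi s t) := .pi s.countable_toSet fun k _ => ht k
  rw [Measure.map_apply hm hs]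
  have e : (fun p : (∀ k, X k) × X i => Function.update p.1 i p.2) ⁻¹' (Set.pi s t)
      = Set.pi ↑(s.erase i) t ×ˢ (if i ∈ s then t i else Set.univ) := by
    ext ⟨p, q⟩
    simp only [Set.mem_preimage, Set.mem_pi, Finset.mem_coe, Set.mem_prod, Finset.mem_erase]
    constructor
    · intro h
      refine ⟨fun k hk => by simpa [hk.1] using h k hk.2, ?_⟩
      split_ifs with hi
      · simpa using h i hi
      · trivial
    · rintro ⟨h1, h2⟩ k hk
      by_cases h : k = i
      · subst h; simpa [hk] using h2
      · simpa [h] using h1 k ⟨h, hk⟩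
  rw [e, Measure.prod_prod, Measure.infinitePi_pi _ (fun k _ => ht k)]
  have e2 : ∏ k ∈ s.erase i, μ k (t k) = ∏ k ∈ s.erase i, (Function.update μ i ρ) k (t k) :=
    Finset.prod_congr rfl fun k hk => by rw [Function.update_of_ne (Finset.ne_of_mem_erase hk)]
  rw [e2]
  split_ifs with hi
  · rw [← Finset.prod_erase_mul s _ hi, Function.update_self]
  · rw [measure_univ, mul_one, Finset.erase_eq_of_notMem hi]

/-- Bounding finitely many factors of a product measure bounds the product measure. -/
lemma infinitePi_le_smul_of_factors (μ ρ : ∀ i, Measure (X i)) [∀ i, IsProbabilityMeasure (μ i)]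
    [∀ i, IsProbabilityMeasure (ρ i)] (c : ι → ENNReal)
    (I : Finset ι) (hc : ∀ i ∈ I, ρ i ≤ c i • μ i) (hI : ∀ i ∉ I, ρ i = μ i) :
    Measure.infinitePi ρ ≤ (∏ i ∈ I, c i) • Measure.infinitePi μ := by
  classical
  induction I using Finset.induction_on generalizing ρ with
  | empty =>
    have : ρ = μ := funext fun i => hI i (by simp)
    subst this
    simp
  | insert i I hi ih =>
    have hprob : ∀ (ξ : Measure (X i)) [IsProbabilityMeasure ξ] (k : ι),
        IsProbabilityMeasure (Function.update ρ i ξ k) := by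
      intro ξ _ k
      by_cases h : k = i
      · subst h; rw [Function.update_self]; infer_instance
      · rw [Function.update_of_ne h]; infer_instance
    have := hprob (μ i)
    have h1 := ih (Function.update ρ i (μ i)) (fun k hk => by
        rw [Function.update_of_ne (by rintro rfl; exact hi hk)]
        exact hc k (Finset.mem_insert_of_mem hk)) (fun k hk => by
        by_cases h : k = i
        · subst h; rw [Function.update_self]
        · rw [Function.update_of_ne h]; exact hI k (by simp [h, hk]))
    -- Both products are images of `infinitePi ρ` times one factor under overwriting coordinate `i`,
    -- with factor `ρ i` on the left and `μ i` on the right. The comparison then reduces to sections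
    -- in that single factor.
    have h2 : Measure.infinitePi ρ ≤ c i • Measure.infinitePi (Function.update ρ i (μ i)) := by
      rw [← map_update_infinitePi_prod ρ i (μ i) rfl, ← Measure.map_smul]
      conv_lhs => rw [← map_update_infinitePi_prod ρ i (ρ i) (Function.update_eq_self i ρ).symm]
      refine Measure.map_mono ?_ (measurable_update_prod i)
      refine Measure.le_iff.2 fun s hs => ?_
      rw [Measure.smul_apply, smul_eq_mul, Measure.prod_apply hs, Measure.prod_apply hs,
        ← lintegral_const_mul _ (measurable_measure_prodMk_left hs)]
      refine lintegral_mono fun p => ?_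
      simpa using hc i (Finset.mem_insert_self i I) (Prod.mk p ⁻¹' s)
    rw [Finset.prod_insert hi, mul_smul]
    refine h2.trans ?_
    refine Measure.le_iff.2 fun s _ => ?_
    simp only [Measure.smul_apply, smul_eq_mul]
    gcongr
    simpa using h1 s

end ProductShift

/-- Shifting finitely many coordinates of a product of Laplace distributions. -/
lemma map_shift_infinitePi_laplace_le {ι : Type*} (b : ι → ℝ) (I : Finset ι) (δ : ι → ℝ)
    (hb : ∀ i ∈ I, 0 < b i) (hδ : ∀ i ∉ I, δ i = 0) :
    (Measure.infinitePi fun i => laplace (b i)).map (fun z i => z i + δ i)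
      ≤ ENNReal.ofReal (Real.exp (∑ i ∈ I, |δ i| / b i))
        • Measure.infinitePi fun i => laplace (b i) := by
  have hm : ∀ i, Measurable fun y : ℝ => y + δ i := fun i => by fun_prop
  have (i : ι) : IsProbabilityMeasure ((laplace (b i)).map (fun y => y + δ i)) :=
    Measure.isProbabilityMeasure_map (hm i).aemeasurable
  rw [Measure.infinitePi_map_pi _ hm, Real.exp_sum,
    ENNReal.ofReal_prod_of_nonneg fun i _ => Real.exp_nonneg _]
  refine infinitePi_le_smul_of_factors (fun i => laplace (b i)) _ _ I
    (fun i hi => map_add_laplace_le (hb i hi) (δ i)) fun i hi => ?_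
  simp [hδ i hi]

/-! ### Arithmetic of blocks and of the dyadic partition. -/

section Blocks

lemma two_pow_blockIndex_le (n : ℕ) : 2 ^ blockIndex n ≤ n + 1 :=
  Nat.pow_log_le_self 2 (Nat.succ_ne_zero n)

lemma lt_two_pow_blockIndex_succ (n : ℕ) : n + 1 < 2 ^ (blockIndex n + 1) :=
  Nat.lt_pow_succ_log_self one_lt_two (n + 1)

lemma openCount_lt (n : ℕ) : openCount n < 2 ^ blockIndex n := by
  have h1 := two_pow_blockIndex_le n
  have h2 := lt_two_pow_blockIndex_succ n
  have h3 : 0 < 2 ^ blockIndex n := by positivity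
  rw [pow_succ] at h2
  unfold openCount
  omega

lemma blockIndex_mono {m n : ℕ} (h : m ≤ n) : blockIndex m ≤ blockIndex n :=
  Nat.log_mono_right (Nat.succ_le_succ h)

lemma mem_block_iff (i s : ℕ) :
    i ∈ Finset.Ico (2 ^ s - 1) (2 ^ (s + 1) - 1) ↔ s = blockIndex i := by
  have h3 : 0 < 2 ^ s := by positivity
  rw [Finset.mem_Ico, eq_comm, blockIndex, Nat.log_eq_iff (Or.inr ⟨one_lt_two, by omega⟩), pow_succ]
  omega

/-- The noise nodes of the tree sum, as a sum over binary digits. -/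
lemma sum_pSumNodes {c s : ℕ} (hc : c < 2 ^ s) (f : ℕ × ℕ → ℝ) :
    ∑ v ∈ pSumNodes c, f v
      = ∑ k ∈ Finset.range s, if c.testBit k then f (k, c / 2 ^ k - 1) else 0 := by
  have e : (Finset.range c).filter (fun k => c.testBit k)
      = (Finset.range s).filter (fun k => c.testBit k) := by
    ext k
    simp only [Finset.mem_filter, Finset.mem_range, and_congr_left_iff]
    intro hk
    have h1 : 2 ^ k ≤ c := Nat.ge_two_pow_of_testBit hk
    have h2 : k < 2 ^ k := Nat.lt_two_pow_self
    exact ⟨fun _ => (Nat.pow_lt_pow_iff_right one_lt_two).1 (h1.trans_lt hc), fun _ => by omega⟩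
  rw [pSumNodes, e, Finset.sum_image (by intro a _ b _ h; exact (Prod.mk.inj h).1),
    Finset.sum_filter]

/-- A leaf among the first `c` leaves is covered by exactly one node of the partition of these
leaves, other leaves are covered by none. -/
lemma sum_covering_nodes {c l s : ℕ} (hc : c < 2 ^ s) (δ : ℝ) :
    (∑ k ∈ Finset.range s, if c.testBit k then (if c / 2 ^ k - 1 = l / 2 ^ k then δ else 0) else 0)
      = if l < c then δ else 0 := by
  -- A telescoping invariant: the nodes of level below `m` cover those leaves `l < c` whose block of
  -- length `2 ^ m` is not wholly among the first `c` leaves. At `m = s` the correction vanishes.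
  have key : ∀ m, (∑ k ∈ Finset.range m,
      if c.testBit k then (if c / 2 ^ k - 1 = l / 2 ^ k then δ else 0) else 0)
      = (if l < c then δ else 0) - if l / 2 ^ m < c / 2 ^ m then δ else 0 := by
    intro m
    induction m with
    | zero => simp
    | succ m ih =>
      rw [Finset.sum_range_succ, ih, pow_succ, ← Nat.div_div_eq_div_mul, ← Nat.div_div_eq_div_mul]
      generalize hp : l / 2 ^ m = p
      generalize hq : c / 2 ^ m = q
      -- A node occurs only when `q` is odd, so the truncated `q - 1` is a true predecessor.
      have hb : c.testBit m = decide (q % 2 = 1) := by rw [Nat.testBit_eq_decide_div_mod_eq, hq]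
      simp only [hb, decide_eq_true_eq]
      by_cases h1 : q % 2 = 1 <;> by_cases h2 : q - 1 = p <;> by_cases h3 : p < q <;>
        by_cases h4 : p / 2 < q / 2 <;> simp only [h1, h2, h3, h4, if_true, if_false] <;>
        first | (exfalso; omega) | ring
  rw [key s, Nat.div_eq_of_lt hc]
  simp

end Blocks

/-! ### Translating the noise to hide one changed observation. -/

section Coupling

variable {K : ℕ}

open Classical in
/-- The noise variables that enter sums containing observation number `i` of arm `j`. -/
noncomputable def affectedNoise (j : Fin K) (i : ℕ) : Finset (NoiseIndex K) :=
  insert (.array j (blockIndex i)) ((Finset.range (blockIndex i)).image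
    fun k => .node j (blockIndex i) k ((i - (2 ^ blockIndex i - 1)) / 2 ^ k))

open Classical in
/-- The shift of the noise that compensates a change by `δ` of observation number `i` of arm `j`. -/
noncomputable def noiseShift (j : Fin K) (i : ℕ) (δ : ℝ) (v : NoiseIndex K) : ℝ :=
  if v ∈ affectedNoise j i then δ else 0

lemma noiseShift_array (j a : Fin K) (i s : ℕ) (δ : ℝ) :
    noiseShift j i δ (.array a s) = if a = j ∧ s = blockIndex i then δ else 0 := by
  simp [noiseShift, affectedNoise]

lemma noiseShift_node (j a : Fin K) (i s k p : ℕ) (δ : ℝ) :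
    noiseShift j i δ (.node a s k p) = if a = j ∧ s = blockIndex i ∧ k < blockIndex i ∧
      p = (i - (2 ^ blockIndex i - 1)) / 2 ^ k then δ else 0 := by
  simp only [noiseShift, affectedNoise, Finset.mem_insert, Finset.mem_image, Finset.mem_range,
    reduceCtorEq, false_or, NoiseIndex.node.injEq]
  congr 1
  apply propext
  constructor
  · rintro ⟨q, h1, h2, h3, h4, h5⟩
    subst h4
    exact ⟨h2.symm, h3.symm, h1, h5.symm⟩
  · rintro ⟨h1, h2, h3, h4⟩
    exact ⟨k, h3, h1.symm, h2.symm, rfl, h4.symm⟩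

/-- `obs'` arises from `obs` by decreasing observation number `i`, if it is among the first `n`
ones, by `δ`. -/
def ObsShift (i n : ℕ) (δ : ℝ) (obs obs' : ℕ → ℝ) : Prop :=
  (i < n → obs' i + δ = obs i) ∧ ∀ m, m ≠ i → obs' m = obs m

/-- Only the block of `i` matters. Its array noise is read only after the block is full; then the
reward loses `δ` and the noise gains it. -/
lemma noisyArraySum_shift {j : Fin K} {i n : ℕ} {δ : ℝ} {obs obs' : ℕ → ℝ}
    (h : ObsShift i n δ obs obs') (z : NoiseIndex K → ℝ) :
    noisyArraySum (fun v => z v + noiseShift j i δ v) j (blockIndex n) obs'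
      = noisyArraySum z j (blockIndex n) obs := by
  refine Finset.sum_congr rfl fun s hs => ?_
  rw [Finset.mem_range] at hs
  simp only [noiseShift_array]
  by_cases hsi : s = blockIndex i
  · have hin : i < n := by
      by_contra hni
      exact absurd (blockIndex_mono (not_lt.1 hni)) (by omega)
    have hmem := (mem_block_iff i s).2 hsi
    rw [← Finset.sum_erase_add _ _ hmem, ← Finset.sum_erase_add _ _ hmem, if_pos ⟨trivial, hsi⟩,
      ← h.1 hin, Finset.sum_congr rfl fun m hm => h.2 m (Finset.ne_of_mem_erase hm)]
    ring
  · rw [if_neg fun hh => hsi hh.2, add_zero, Finset.sum_congr rfl fun m hm => h.2 m ?_]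
    rintro rfl
    exact hsi ((mem_block_iff m s).1 hm)

/-- If the open block is that of `i`, its partition contains exactly one translated node when `i`
has been observed and none before. Trees of other blocks contain neither `i` nor translated noise.
-/
lemma noisyTreeSum_shift {j : Fin K} {i n : ℕ} {δ : ℝ} {obs obs' : ℕ → ℝ}
    (h : ObsShift i n δ obs obs') (z : NoiseIndex K → ℝ) :
    noisyTreeSum (fun v => z v + noiseShift j i δ v) j (blockIndex n) (openCount n) obs'
      = noisyTreeSum z j (blockIndex n) (openCount n) obs := by
  have hc := openCount_lt n
  have hi1 := two_pow_blockIndex_le i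
  have hi2 := lt_two_pow_blockIndex_succ i
  have hn1 := two_pow_blockIndex_le n
  unfold noisyTreeSum
  rw [Finset.sum_add_distrib]
  by_cases hr : blockIndex n = blockIndex i
  · have hshift : ∑ v ∈ pSumNodes (openCount n),
        noiseShift j i δ (.node j (blockIndex n) v.1 v.2)
        = if i - (2 ^ blockIndex i - 1) < openCount n then δ else 0 := by
      rw [sum_pSumNodes hc, ← sum_covering_nodes hc]
      refine Finset.sum_congr rfl fun k hk => ?_
      rw [Finset.mem_range, hr] at hk
      simp only [noiseShift_node, hr, true_and, hk]
    rw [hshift]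
    have hcn : openCount n = n - (2 ^ blockIndex i - 1) := by rw [openCount, hr]
    rw [hr] at hn1
    split_ifs with hl
    · have hin : i < n := by omega
      have hmem := Finset.mem_range.2 hl
      rw [← Finset.sum_erase_add _ _ hmem, ← Finset.sum_erase_add _ _ hmem]
      have e : 2 ^ blockIndex n - 1 + (i - (2 ^ blockIndex i - 1)) = i := by rw [hr]; omega
      rw [e, ← h.1 hin, Finset.sum_congr rfl fun m hm => h.2 _ ?_]
      · ring
      · have := Finset.ne_of_mem_erase hm
        rw [hr]; omega
    · rw [add_zero, Finset.sum_congr rfl fun m hm => h.2 _ ?_]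
      rw [Finset.mem_range] at hm
      rw [hr]; omega
  · have hshift : ∑ v ∈ pSumNodes (openCount n),
        noiseShift j i δ (.node j (blockIndex n) v.1 v.2) = 0 :=
      Finset.sum_eq_zero fun v _ => by rw [noiseShift_node, if_neg fun hh => hr hh.2.1]
    rw [hshift, add_zero, Finset.sum_congr rfl fun m hm => h.2 _ ?_]
    rw [Finset.mem_range] at hm
    rintro rfl
    refine hr ((mem_block_iff _ _).1 ?_)
    rw [Finset.mem_Ico, pow_succ]
    omega

/-- The noise shift hides the change of an observation from the private mean. -/
lemma privateMean_shift {j : Fin K} {i n : ℕ} {δ : ℝ} {obs obs' : ℕ → ℝ}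
    (h : ObsShift i n δ obs obs') (z : NoiseIndex K → ℝ) :
    privateMean (fun v => z v + noiseShift j i δ v) j n obs' = privateMean z j n obs := by
  rw [privateMean, privateMean, noisyArraySum_shift h, noisyTreeSum_shift h]

lemma privateMean_shift_of_ne {j a : Fin K} (ha : a ≠ j) (i n : ℕ) (δ : ℝ) (obs : ℕ → ℝ)
    (z : NoiseIndex K → ℝ) :
    privateMean (fun v => z v + noiseShift j i δ v) a n obs = privateMean z a n obs := by
  unfold privateMean noisyArraySum noisyTreeSum
  simp [noiseShift_array, noiseShift_node, ha]

/-- `st'` arises from `st` by decreasing observation number `i` of arm `j` by `δ`. -/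
def StateShift (j : Fin K) (i : ℕ) (δ : ℝ) (st st' : BanditState K) : Prop :=
  (∀ a, (st' a).1 = (st a).1) ∧ (∀ a, a ≠ j → (st' a).2 = (st a).2) ∧
    ObsShift i (st j).1 δ (st j).2 (st' j).2

variable {sel : (Fin K → ℝ) → Fin K} {ε : ℝ}

lemma pullArm_shift {j : Fin K} {i : ℕ} {δ : ℝ} {st st' : BanditState K}
    (h : StateShift j i δ st st') (z : NoiseIndex K → ℝ) (t : ℕ) :
    pullArm sel ε (fun v => z v + noiseShift j i δ v) t st' = pullArm sel ε z t st := by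
  unfold pullArm
  split_ifs with ht
  · rfl
  · congr 1
    funext a
    unfold ucbIndex
    congr 2
    rw [h.1 a]
    · by_cases ha : a = j
      · subst ha
        exact privateMean_shift h.2.2 z
      · rw [h.2.1 a ha, privateMean_shift_of_ne ha]
    all_goals rw [h.1 a]

/-- The condition `a = j ∧ (st j).1 = i` says that the changed observation is being stored. -/
lemma insertObs_shift {j a : Fin K} {i : ℕ} {δ y y' : ℝ} {st st' : BanditState K}
    (h : StateShift j i δ st st') (hne : ¬(a = j ∧ (st j).1 = i) → y' = y)
    (heq : a = j ∧ (st j).1 = i → y' + δ = y) :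
    StateShift j i δ (insertObs st a y) (insertObs st' a y') := by
  obtain ⟨h1, h2, h3, h4⟩ := h
  refine ⟨fun b => ?_, fun b hb => ?_, ?_⟩
  · by_cases hba : b = a
    · subst hba; simp [insertObs_self, h1]
    · simp [insertObs_of_ne _ hba, h1]
  · by_cases hba : b = a
    · subst hba
      simp [insertObs_self, h1, h2 b hb, hne fun hh => hb hh.1]
    · simp [insertObs_of_ne _ hba, h2 b hb]
  · by_cases hja : j = a
    · subst hja
      simp only [insertObs_self, h1]
      refine ⟨fun hi => ?_, fun m hm => ?_⟩
      · by_cases hii : i = (st j).1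
        · simp [hii, heq ⟨rfl, hii.symm⟩]
        · rw [Function.update_of_ne hii, Function.update_of_ne hii]
          exact h3 (by omega)
      · by_cases hmi : m = (st j).1
        · simp [hmi, hne fun hh => hm (hmi.trans hh.2)]
        · rw [Function.update_of_ne hmi, Function.update_of_ne hmi, h4 m hm]
    · simp only [insertObs_of_ne _ hja]
      exact ⟨h3, h4⟩

/-- Runs on neighbouring reward sequences with suitably shifted noise make the same decisions. -/
lemma hybridUCB_shift {x x' : ℕ → Fin K → ℝ} {τ : ℕ} (hx : ∀ t, t ≠ τ → x t = x' t)
    (z : NoiseIndex K → ℝ) {j : Fin K} {i : ℕ} (hj : hybridUCB sel ε x z τ = j)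
    (hi : pullCount (hybridUCB sel ε x z) j τ = i) (t : ℕ) :
    hybridUCB sel ε x' (fun v => z v + noiseShift j i (x τ j - x' τ j) v) t
      = hybridUCB sel ε x z t := by
  suffices h : StateShift j i (x τ j - x' τ j) (hybridState sel ε x z t)
      (hybridState sel ε x' (fun v => z v + noiseShift j i (x τ j - x' τ j) v) t) from
    pullArm_shift h z t
  induction t with
  | zero => exact ⟨fun _ => rfl, fun _ _ => rfl, fun h => absurd h (Nat.not_lt_zero _),
      fun _ _ => rfl⟩
  | succ t ih =>
    have hp : hybridUCB sel ε x' (fun v => z v + noiseShift j i (x τ j - x' τ j) v) t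
      = hybridUCB sel ε x z t := pullArm_shift ih z t
    rw [hybridState_succ, hybridState_succ, hp]
    refine insertObs_shift ih (fun h => ?_) (fun h => ?_)
    · by_cases ht : t = τ
      · subst ht
        exact absurd ⟨hj, by rw [hybridState_fst, hi]⟩ h
      · rw [hx t ht]
    -- Observation `i` of arm `j` is made only once, in round `τ`, where the rewards differ by the
    -- chosen shift.
    · have ht : t = τ := eq_of_pullCount_eq h.1 hj (by rw [hi, ← h.2, hybridState_fst])
      subst ht
      rw [hj]
      ring

end Coupling

/-! ### Differential privacy. -/

section Privacy

variable {K : ℕ} {sel : (Fin K → ℝ) → Fin K} {ε : ℝ}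

lemma sum_affectedNoise_le (hε : 0 < ε) (j : Fin K) (i : ℕ) {δ : ℝ} (hδ : |δ| ≤ 1) :
    ∑ v ∈ affectedNoise j i, |noiseShift j i δ v| / noiseScale ε v ≤ ε := by
  classical
  have h1 : ∑ v ∈ affectedNoise j i, |noiseShift j i δ v| / noiseScale ε v
      = ∑ v ∈ affectedNoise j i, |δ| / noiseScale ε v :=
    Finset.sum_congr rfl fun v hv => by rw [noiseShift, if_pos hv]
  rw [h1, affectedNoise, Finset.sum_insert (by simp),
    Finset.sum_image (fun a _ b _ h => by injection h)]
  simp only [noiseScale, Finset.sum_const, Finset.card_range, nsmul_eq_mul]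
  -- Block `0` has no translated nodes and costs at most `ε / 2`. Otherwise the `r` nodes, each of
  -- scale `r / (ε / 2)`, cost at most another `ε / 2`.
  rcases (blockIndex i).eq_zero_or_pos with h0 | h0
  · rw [h0]
    simp only [Nat.cast_zero, zero_mul, add_zero]
    rw [div_div_eq_mul_div, div_one]
    nlinarith
  · have : (0 : ℝ) < blockIndex i := by exact_mod_cast h0
    rw [div_div_eq_mul_div, div_one, div_div_eq_mul_div, mul_div_cancel₀ _ this.ne']
    nlinarith

lemma noiseScale_pos_of_mem_affectedNoise (hε : 0 < ε) {j : Fin K} {i : ℕ} {v : NoiseIndex K}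
    (hv : v ∈ affectedNoise j i) : 0 < noiseScale ε v := by
  classical
  rcases Finset.mem_insert.1 hv with rfl | hv
  · simp only [noiseScale]; positivity
  · obtain ⟨k, hk, rfl⟩ := Finset.mem_image.1 hv
    have : (0 : ℝ) < blockIndex i := by
      exact_mod_cast (Nat.zero_le k).trans_lt (Finset.mem_range.1 hk)
    simp only [noiseScale]; positivity

lemma noiseMeasure_decisions_le (hε : 0 < ε) {x x' : ℕ → Fin K → ℝ} (hx : IsRewardSeq x)
    (hx' : IsRewardSeq x') (h : AreNeighbours x x') (T : ℕ) (d : Fin T → Fin K) :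
    noiseMeasure K ε {z | (fun t : Fin T => hybridUCB sel ε x z t) = d}
      ≤ ENNReal.ofReal (Real.exp ε)
        * noiseMeasure K ε {z | (fun t : Fin T => hybridUCB sel ε x' z t) = d} := by
  obtain ⟨τ, hτ⟩ := h
  rcases lt_or_ge τ T with hT | hT
  · set j := d ⟨τ, hT⟩
    set J : ℕ → Fin K := fun t => if ht : t < T then d ⟨t, ht⟩ else j
    -- `i` depends on `d` and not on `z`, so one fixed translation serves every noise leading to
    -- `d`. The values of `J` from `T` on are irrelevant.
    set i := pullCount J j τ
    set δ := x τ j - x' τ j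
    have hδ : |δ| ≤ 1 := by
      rw [abs_le]
      have h1 := hx τ j
      have h2 := hx' τ j
      exact ⟨by linarith [h1.1, h2.2], by linarith [h1.2, h2.1]⟩
    have hm : Measurable fun (z : NoiseIndex K → ℝ) v => z v + noiseShift j i δ v := by fun_prop
    have hsub : {z | (fun t : Fin T => hybridUCB sel ε x z t) = d}
        ⊆ (fun (z : NoiseIndex K → ℝ) v => z v + noiseShift j i δ v) ⁻¹'
          {z | (fun t : Fin T => hybridUCB sel ε x' z t) = d} := by
      intro z hz
      have hz' : ∀ t (ht : t < T), hybridUCB sel ε x z t = d ⟨t, ht⟩ := fun t ht =>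
        congrFun (hz : (fun t : Fin T => hybridUCB sel ε x z t) = d) ⟨t, ht⟩
      have hc : pullCount (hybridUCB sel ε x z) j τ = i :=
        pullCount_congr (fun s hs => by
          rw [hz' s (hs.trans hT)]; simp only [J, dif_pos (hs.trans hT)]) j
      funext t
      exact (hybridUCB_shift hτ z (hz' τ hT) hc t).trans (hz' t t.2)
    have hle := map_shift_infinitePi_laplace_le (noiseScale ε) (affectedNoise j i)
      (noiseShift j i δ) (fun v hv => noiseScale_pos_of_mem_affectedNoise hε hv)
      (fun v hv => if_neg hv)
    calc noiseMeasure K ε {z | (fun t : Fin T => hybridUCB sel ε x z t) = d}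
        ≤ _ := measure_mono hsub
      _ ≤ _ := Measure.le_map_apply hm.aemeasurable _
      _ ≤ _ := hle _
      _ ≤ _ := by
        rw [Measure.smul_apply, smul_eq_mul]
        gcongr ?_ * _
        · exact ENNReal.ofReal_le_ofReal (Real.exp_le_exp.2 (sum_affectedNoise_le hε j i hδ))
  -- A change after the horizon cannot influence any decision under consideration.
  · have e : ∀ z (t : Fin T), hybridUCB sel ε x z t = hybridUCB sel ε x' z t := fun z t =>
      hybridUCB_congr z fun s hs => hτ s (by have := t.2; omega)
    simp only [e]
    refine le_mul_of_one_le_left zero_le ?_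
    rw [ENNReal.one_le_ofReal]
    exact Real.one_le_exp hε.le

/-- Hybrid-UCB is differentially private. -/
theorem isDifferentiallyPrivate_hybridUCB (hsel : Measurable sel) (hε : 0 < ε) (T : ℕ) :
    IsDifferentiallyPrivate (noiseMeasure K ε) (hybridUCB sel ε) ε T := by
  classical
  intro x x' hx hx' h D
  have hD : ∀ y : ℕ → Fin K → ℝ, {z | (fun t : Fin T => hybridUCB sel ε y z t) ∈ D}
      = ⋃ d ∈ D.toFinset, {z | (fun t : Fin T => hybridUCB sel ε y z t) = d} := by
    intro y; ext z; simp
  have hmeas : ∀ d ∈ D.toFinset,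
      MeasurableSet {z | (fun t : Fin T => hybridUCB sel ε x' z t) = d} := by
    intro d _
    have : Measurable fun z => (fun t : Fin T => hybridUCB sel ε x' z t) :=
      measurable_pi_iff.2 fun t =>
        measurable_hybridUCB hsel (X := fun _ => x') measurable_const measurable_id t
    exact this (measurableSet_singleton d)
  have hdisj : Set.PairwiseDisjoint (↑D.toFinset)
      fun d => {z | (fun t : Fin T => hybridUCB sel ε x' z t) = d} := by
    intro d _ d' _ hne
    refine Set.disjoint_left.2 fun z hz hz' => hne ?_
    exact (hz : _ = d).symm.trans hz'
  rw [hD x, hD x', measure_biUnion_finset hdisj hmeas, Finset.mul_sum]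
  exact (measure_biUnion_finset_le _ _).trans
    (Finset.sum_le_sum fun d _ => noiseMeasure_decisions_le hε hx hx' h T d)

end Privacy

/-! ### Tail of the total noise in a private mean. -/

section NoiseSum

variable {K : ℕ} {ε : ℝ}

/-- The total noise in the sum of the first `n` observations of arm `j`. -/
def noiseSum (z : NoiseIndex K → ℝ) (j : Fin K) (n : ℕ) : ℝ :=
  ∑ s ∈ Finset.range (blockIndex n), z (.array j s)
    + ∑ v ∈ pSumNodes (openCount n), z (.node j (blockIndex n) v.1 v.2)

@[fun_prop]
lemma measurable_noiseSum (j : Fin K) (n : ℕ) :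
    Measurable fun z : NoiseIndex K → ℝ => noiseSum z j n := by
  unfold noiseSum; fun_prop

lemma sum_blocks (r : ℕ) (obs : ℕ → ℝ) :
    ∑ s ∈ Finset.range r, ∑ i ∈ Finset.Ico (2 ^ s - 1) (2 ^ (s + 1) - 1), obs i
      = ∑ i ∈ Finset.range (2 ^ r - 1), obs i := by
  induction r with
  | zero => simp
  | succ r ih =>
    rw [Finset.sum_range_succ, ih, Finset.sum_range_add_sum_Ico]
    have : 2 ^ r ≤ 2 ^ (r + 1) := Nat.pow_le_pow_right two_pos (Nat.le_succ r)
    omega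

/-- The full blocks and the open block exhaust the observations, so sampling error and noise can be
treated separately. -/
lemma privateMean_eq (z : NoiseIndex K → ℝ) (j : Fin K) (n : ℕ) (obs : ℕ → ℝ) :
    privateMean z j n obs = (∑ i ∈ Finset.range n, obs i + noiseSum z j n) / n := by
  have hn : n = 2 ^ blockIndex n - 1 + openCount n := by
    have := two_pow_blockIndex_le n
    unfold openCount
    omega
  have h : ∑ i ∈ Finset.range n, obs i = ∑ i ∈ Finset.range (2 ^ blockIndex n - 1), obs i
      + ∑ i ∈ Finset.range (openCount n), obs (2 ^ blockIndex n - 1 + i) := by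
    conv_lhs => rw [hn]
    exact Finset.sum_range_add _ _ _
  rw [privateMean, noisyArraySum, noisyTreeSum, noiseSum, Finset.sum_add_distrib, sum_blocks, h]
  congr 1
  ring

open Classical in
/-- The noise variables in the sum of the first `n` observations of arm `j`. -/
noncomputable def noiseSupport (j : Fin K) (n : ℕ) : Finset (NoiseIndex K) :=
  (Finset.range (blockIndex n)).image (fun s => .array j s) ∪
    (pSumNodes (openCount n)).image (fun v => .node j (blockIndex n) v.1 v.2)

lemma sum_noiseSupport (j : Fin K) (n : ℕ) (f : NoiseIndex K → ℝ) :
    ∑ v ∈ noiseSupport j n, f v = ∑ s ∈ Finset.range (blockIndex n), f (.array j s)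
      + ∑ v ∈ pSumNodes (openCount n), f (.node j (blockIndex n) v.1 v.2) := by
  classical
  rw [noiseSupport, Finset.sum_union, Finset.sum_image, Finset.sum_image]
  · intro a _ b _ h
    injection h with _ _ h1 h2
    exact Prod.ext h1 h2
  · intro a _ b _ h
    injection h
  · rw [Finset.disjoint_left]
    intro v hv hv'
    obtain ⟨_, _, rfl⟩ := Finset.mem_image.1 hv
    obtain ⟨_, _, h⟩ := Finset.mem_image.1 hv'
    cases h

lemma card_pSumNodes_le {c s : ℕ} (hc : c < 2 ^ s) : (pSumNodes c).card ≤ s := by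
  have h := sum_pSumNodes hc (fun _ => 1)
  rw [Finset.sum_const, nsmul_eq_mul, mul_one] at h
  have h2 : ∑ k ∈ Finset.range s, (if c.testBit k then (1 : ℝ) else 0) ≤ s := by
    refine (Finset.sum_le_sum (g := fun _ => (1 : ℝ)) fun k _ => ?_).trans (by simp)
    split_ifs <;> norm_num
  exact_mod_cast h ▸ h2

/-- The node scale dominates the array scale because the block index is at least `1`. A common bound
allows one exponent for all variables in the Chernoff bound. -/
lemma noiseScale_le (hε : 0 < ε) {j : Fin K} {n : ℕ} (hn : 1 ≤ blockIndex n) {v : NoiseIndex K}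
    (hv : v ∈ noiseSupport j n) :
    0 ≤ noiseScale ε v ∧ noiseScale ε v ≤ 2 * blockIndex n / ε := by
  classical
  have h1 : (1 : ℝ) ≤ blockIndex n := by exact_mod_cast hn
  rcases Finset.mem_union.1 hv with hv | hv
  · obtain ⟨s, _, rfl⟩ := Finset.mem_image.1 hv
    simp only [noiseScale]
    refine ⟨by positivity, ?_⟩
    rw [div_le_div_iff₀ (by positivity) hε]
    nlinarith
  · obtain ⟨s, _, rfl⟩ := Finset.mem_image.1 hv
    simp only [noiseScale]
    refine ⟨by positivity, le_of_eq ?_⟩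
    field_simp
    norm_num

lemma sum_sq_noiseScale_le (hε : 0 < ε) (j : Fin K) (n : ℕ) :
    ∑ v ∈ noiseSupport j n, (noiseScale ε v) ^ 2
      ≤ 4 * (blockIndex n + (blockIndex n : ℝ) ^ 3) / ε ^ 2 := by
  rw [sum_noiseSupport]
  simp only [noiseScale, Finset.sum_const, Finset.card_range, nsmul_eq_mul]
  have h : ((pSumNodes (openCount n)).card : ℝ) ≤ blockIndex n := by
    exact_mod_cast card_pSumNodes_le (openCount_lt n)
  calc _ ≤ (blockIndex n : ℝ) * (1 / (0.5 * ε)) ^ 2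
        + blockIndex n * (blockIndex n / (0.5 * ε)) ^ 2 := by gcongr
    _ = _ := by field_simp; norm_num; ring

lemma indep_noise (K : ℕ) (ε : ℝ) :
    ProbabilityTheory.iIndepFun (fun (v : NoiseIndex K) (z : NoiseIndex K → ℝ) => z v)
      (noiseMeasure K ε) :=
  ProbabilityTheory.iIndepFun_infinitePi (X := fun _ y => y) fun _ => measurable_id

instance (K : ℕ) (ε : ℝ) : IsProbabilityMeasure (noiseMeasure K ε) := by
  unfold noiseMeasure; infer_instance

lemma measurePreserving_noise (ε : ℝ) (v : NoiseIndex K) :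
    MeasurePreserving (fun z : NoiseIndex K → ℝ => z v) (noiseMeasure K ε)
      (laplace (noiseScale ε v)) :=
  measurePreserving_eval_infinitePi (fun v : NoiseIndex K => laplace (noiseScale ε v)) v

lemma mgf_noise_le {l : ℝ} {v : NoiseIndex K} (h0 : 0 ≤ noiseScale ε v)
    (h : |l * noiseScale ε v| ≤ 1 / 2) :
    Integrable (fun z => Real.exp (l * z v)) (noiseMeasure K ε) ∧
      ProbabilityTheory.mgf (fun z : NoiseIndex K → ℝ => z v) (noiseMeasure K ε) l
        ≤ Real.exp (2 * (l * noiseScale ε v) ^ 2) := by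
  have hmp := measurePreserving_noise ε v
  have hi := (integrable_exp_mul_laplace h0 (by linarith : |l * noiseScale ε v| < 1)).1
  refine ⟨hmp.integrable_comp_of_integrable hi, ?_⟩
  refine le_trans (le_of_eq ?_) (integral_exp_mul_laplace_le h0 h)
  rw [ProbabilityTheory.mgf, ← hmp.map_eq, integral_map hmp.measurable.aemeasurable]
  rw [hmp.map_eq]
  exact hi.aestronglyMeasurable

/-- The moment generating function of the total noise. -/
lemma mgf_noiseSum_le (hε : 0 < ε) (j : Fin K) {n : ℕ} (hn : 1 ≤ blockIndex n) {l : ℝ}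
    (hl : |l| = ε / (4 * blockIndex n)) :
    Integrable (fun z => Real.exp (l * noiseSum z j n)) (noiseMeasure K ε) ∧
      ProbabilityTheory.mgf (fun z => noiseSum z j n) (noiseMeasure K ε) l
        ≤ Real.exp ((1 + blockIndex n) / 2) := by
  have h1 : (1 : ℝ) ≤ blockIndex n := by exact_mod_cast hn
  have hlb : ∀ v ∈ noiseSupport j n, |l * noiseScale ε v| ≤ 1 / 2 := by
    intro v hv
    obtain ⟨h2, h3⟩ := noiseScale_le hε hn hv
    rw [abs_mul, hl, abs_of_nonneg h2]
    calc _ ≤ ε / (4 * blockIndex n) * (2 * blockIndex n / ε) := by gcongr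
      _ = 1 / 2 := by field_simp; norm_num
  have e : (fun z : NoiseIndex K → ℝ => noiseSum z j n)
      = ∑ v ∈ noiseSupport j n, fun z : NoiseIndex K → ℝ => z v := by
    funext z
    rw [noiseSum, Finset.sum_apply, sum_noiseSupport]
  have hfac := fun v hv => mgf_noise_le (K := K) (noiseScale_le hε hn hv).1 (hlb v hv)
  constructor
  · have := (indep_noise K ε).integrable_exp_mul_sum (fun v => measurable_pi_apply v)
      (s := noiseSupport j n) (t := l) fun v hv => (hfac v hv).1
    rw [← e] at this
    exact this
  · rw [e, (indep_noise K ε).mgf_sum (fun v => measurable_pi_apply v)]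
    calc _ ≤ ∏ v ∈ noiseSupport j n, Real.exp (2 * (l * noiseScale ε v) ^ 2) :=
          Finset.prod_le_prod (fun _ _ => ProbabilityTheory.mgf_nonneg) fun v hv => (hfac v hv).2
      _ = Real.exp (2 * l ^ 2 * ∑ v ∈ noiseSupport j n, (noiseScale ε v) ^ 2) := by
          rw [← Real.exp_sum, Finset.mul_sum]
          congr 1
          exact Finset.sum_congr rfl fun v _ => by ring
      _ ≤ Real.exp (2 * l ^ 2 * (4 * (blockIndex n + (blockIndex n : ℝ) ^ 3) / ε ^ 2)) := by
          gcongr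
          exact sum_sq_noiseScale_le hε j n
      _ ≤ _ := by
          rw [Real.exp_le_exp, ← sq_abs l, hl]
          -- With `r = blockIndex n`, the cubic term comes from `r` nodes of squared scale of order
          -- `r ^ 2`; the choice of `l` leaves an exponent linear in `r`.
          have h2 : 2 * (ε / (4 * blockIndex n)) ^ 2
              * (4 * (blockIndex n + (blockIndex n : ℝ) ^ 3) / ε ^ 2)
              = (1 / blockIndex n + blockIndex n) / 2 := by
            field_simp; norm_num
          rw [h2]
          have : 1 / (blockIndex n : ℝ) ≤ 1 := by rw [div_le_one (by linarith)]; exact h1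
          linarith

lemma le_sqrt_eight : 2.8 ≤ Real.sqrt 8 := Real.le_sqrt_of_sq_le (by norm_num)

lemma one_le_blockIndex {n : ℕ} (hn : 1 ≤ n) : 1 ≤ blockIndex n :=
  Nat.log_pos one_lt_two (by omega)

/-- The total noise exceeds its confidence width with small probability. -/
lemma noiseSum_tail (hε : 0 < ε) (j : Fin K) {n : ℕ} (hn : 1 ≤ n) {L : ℝ} (hL : 1 ≤ L)
    (hnL : blockIndex n ≤ L) :
    (noiseMeasure K ε).real {z | 6 * Real.sqrt 8 * L * blockIndex n / ε ≤ |noiseSum z j n|}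
      ≤ 2 * Real.exp (-3 * L) := by
  have hb := one_le_blockIndex hn
  have h1 : (1 : ℝ) ≤ blockIndex n := by exact_mod_cast hb
  set u := 6 * Real.sqrt 8 * L * blockIndex n / ε
  set l := ε / (4 * blockIndex n)
  have hl0 : 0 ≤ l := by positivity
  have hlu : 4.2 * L ≤ l * u := by
    have : l * u = 1.5 * Real.sqrt 8 * L := by
      simp only [l, u]; field_simp; norm_num
    rw [this]
    nlinarith [le_sqrt_eight]
  -- Both `1` and the block index are at most `L`, so the exponent is at most `-4.2 L + L`.
  have hexp : Real.exp (-(l * u)) * Real.exp ((1 + blockIndex n) / 2) ≤ Real.exp (-3 * L) := by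
    rw [← Real.exp_add, Real.exp_le_exp]
    linarith
  have hp := mgf_noiseSum_le hε j hb (l := l) (abs_of_nonneg hl0)
  have hm := mgf_noiseSum_le hε j hb (l := -l) (by rw [abs_neg, abs_of_nonneg hl0])
  have tp := ProbabilityTheory.measure_ge_le_exp_mul_mgf u hl0 hp.1
  have tm := ProbabilityTheory.measure_le_le_exp_mul_mgf (-u) (neg_nonpos.2 hl0) hm.1
  have hsub : {z : NoiseIndex K → ℝ | u ≤ |noiseSum z j n|}
      ⊆ {z | u ≤ noiseSum z j n} ∪ {z | noiseSum z j n ≤ -u} := by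
    intro z hz
    rcases le_abs.1 (show u ≤ |noiseSum z j n| from hz) with h | h
    · exact Or.inl h
    · exact Or.inr (show noiseSum z j n ≤ -u by linarith)
  have tp' := tp.trans (mul_le_mul_of_nonneg_left hp.2 (Real.exp_nonneg _))
  have tm' := tm.trans (mul_le_mul_of_nonneg_left hm.2 (Real.exp_nonneg _))
  rw [neg_mul] at tp'
  rw [neg_neg, mul_neg] at tm'
  calc _ ≤ _ := measureReal_mono hsub
    _ ≤ _ := measureReal_union_le _ _
    _ ≤ _ := by linarith

end NoiseSum

/-! ### Splitting the private mean into true mean, sampling error and noise. -/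

section Reward

variable {K : ℕ} {sel : (Fin K → ℝ) → Fin K} {ε : ℝ}

/-- The sum of the stored observations of an arm. -/
lemma sum_obs_hybridState (x : ℕ → Fin K → ℝ) (z : NoiseIndex K → ℝ) (t : ℕ) (a : Fin K) :
    ∑ i ∈ Finset.range (hybridState sel ε x z t a).1, (hybridState sel ε x z t a).2 i
      = ∑ s ∈ Finset.range t, if hybridUCB sel ε x z s = a then x s a else 0 := by
  induction t with
  | zero => rfl
  | succ t ih =>
    rw [Finset.sum_range_succ, ← ih, hybridState_succ]
    split_ifs with h
    · rw [h, insertObs_self]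
      simp only
      rw [Finset.sum_range_succ, Function.update_self]
      congr 1
      refine Finset.sum_congr rfl fun i hi => ?_
      rw [Function.update_of_ne (Finset.mem_range.1 hi).ne]
    · rw [insertObs_of_ne _ (Ne.symm h), add_zero]

/-- The deviation from its mean of the sum of the rewards of arm `j` before round `t`. -/
noncomputable def rewardDeviation (J : ℕ → Fin K) (x : ℕ → Fin K → ℝ) (μ : ℝ) (j : Fin K)
    (t : ℕ) : ℝ :=
  ∑ s ∈ Finset.range t, if J s = j then x s j - μ else 0

lemma rewardDeviation_eq (J : ℕ → Fin K) (x : ℕ → Fin K → ℝ) (μ : ℝ) (j : Fin K) (t : ℕ) :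
    ∑ s ∈ Finset.range t, (if J s = j then x s j else 0)
      = pullCount J j t * μ + rewardDeviation J x μ j t := by
  induction t with
  | zero => simp [rewardDeviation, pullCount_zero]
  | succ t ih =>
    rw [rewardDeviation, Finset.sum_range_succ, Finset.sum_range_succ, ih, pullCount_succ,
      rewardDeviation]
    split_ifs <;> push_cast <;> ring

lemma privateMean_hybridState (x : ℕ → Fin K → ℝ) (z : NoiseIndex K → ℝ) (t : ℕ) (a : Fin K)
    (μ : ℝ) {n : ℕ} (hn : 1 ≤ n) (h : pullCount (hybridUCB sel ε x z) a t = n) :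
    privateMean z a n (hybridState sel ε x z t a).2
      = μ + (rewardDeviation (hybridUCB sel ε x z) x μ a t + noiseSum z a n) / n := by
  have hn' : (n : ℝ) ≠ 0 := by positivity
  have hs := sum_obs_hybridState (sel := sel) (ε := ε) x z t a
  rw [hybridState_fst, rewardDeviation_eq _ _ μ, h] at hs
  rw [privateMean_eq, hs]
  field_simp
  ring

end Reward

/-! ### Independence of one reward vector from everything else. -/

section Independence

/-- Tonelli for a function of the other coordinates times a function of coordinate `t`. -/
lemma lintegral_mul_eval {ι E Z : Type*} [MeasurableSpace E] [MeasurableSpace Z]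
    [DecidableEq ι] (ν : Measure E) [IsProbabilityMeasure ν] (P : Measure Z) [SFinite P] (t : ι)
    {F : (ι → E) × Z → ENNReal} {g : E → ENNReal} (hF : Measurable F) (hg : Measurable g)
    (hFt : ∀ x y z, F (Function.update x t y, z) = F (x, z)) :
    ∫⁻ ω, F ω * g (ω.1 t) ∂((Measure.infinitePi fun _ : ι => ν).prod P)
      = (∫⁻ ω, F ω ∂((Measure.infinitePi fun _ : ι => ν).prod P)) * ∫⁻ v, g v ∂ν := by
  have hgt : Measurable fun ω : (ι → E) × Z => g (ω.1 t) := by fun_prop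
  -- Overwriting coordinate `t` by a fresh sample preserves the law; `F` ignores the overwriting and
  -- `g` sees only the fresh sample.
  have hmap := map_update_infinitePi_prod (fun _ : ι => ν) t ν
    (Function.update_eq_self t fun _ : ι => ν).symm
  have hFg : Measurable fun ω : (ι → E) × Z => F ω * g (ω.1 t) := hF.mul hgt
  rw [lintegral_prod_symm _ hFg.aemeasurable, lintegral_prod_symm _ hF.aemeasurable,
    ← lintegral_mul_const _ hF.lintegral_prod_left']
  refine lintegral_congr fun z => ?_
  have hFz : Measurable fun x => F (x, z) := hF.comp measurable_prodMk_right
  have hFgz : Measurable fun x => F (x, z) * g ((x, z).1 t) := hFg.comp measurable_prodMk_right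
  conv_lhs => rw [← hmap]
  rw [lintegral_map hFgz (measurable_update_prod t)]
  simp only [hFt, Function.update_self]
  exact lintegral_prod_mul hFz.aemeasurable hg.aemeasurable

end Independence

/-! ### Concentration of adaptively collected rewards. -/

section Concentration

variable {K : ℕ} {sel : (Fin K → ℝ) → Fin K} {ε : ℝ} {ν : Measure (Fin K → ℝ)}
  [IsProbabilityMeasure ν]

/-- The joint law of the rewards and the noise. -/
noncomputable abbrev banditMeasure (ν : Measure (Fin K → ℝ)) [IsProbabilityMeasure ν] (ε : ℝ) :
    Measure ((ℕ → Fin K → ℝ) × (NoiseIndex K → ℝ)) :=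
  (Measure.infinitePi fun _ : ℕ => ν).prod (noiseMeasure K ε)

/-- Hoeffding's lemma for the reward of an arm. -/
lemma lintegral_exp_reward_le (hν : ∀ᵐ v ∂ν, ∀ j, v j ∈ Set.Icc (0 : ℝ) 1) (j : Fin K) (l : ℝ) :
    ∫⁻ v, ENNReal.ofReal (Real.exp (l * (v j - armMean ν j) - l ^ 2 / 8)) ∂ν ≤ 1 := by
  have hm : AEMeasurable (fun v : Fin K → ℝ => v j) ν := (measurable_pi_apply j).aemeasurable
  have h := ProbabilityTheory.hasSubgaussianMGF_of_mem_Icc hm (hν.mono fun v hv => hv j)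
  change ProbabilityTheory.HasSubgaussianMGF (fun v => v j - armMean ν j) _ ν at h
  have hi := (h.integrable_exp_mul l).mul_const (Real.exp (-(l ^ 2 / 8)))
  have e : ∀ v : Fin K → ℝ, Real.exp (l * (v j - armMean ν j) - l ^ 2 / 8)
      = Real.exp (l * (v j - armMean ν j)) * Real.exp (-(l ^ 2 / 8)) := fun v => by
    rw [← Real.exp_add, sub_eq_add_neg]
  simp only [e]
  rw [← ofReal_integral_eq_lintegral_ofReal hi (.of_forall fun v => by positivity),
    ENNReal.ofReal_le_one, integral_mul_const]
  have h2 := h.mgf_le l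
  -- An interval of length `1` gives variance proxy `1 / 4`.
  have h3 : (((‖(1 : ℝ) - 0‖₊ / 2) ^ 2 : NNReal) : ℝ) * l ^ 2 / 2 = l ^ 2 / 8 := by
    simp; ring
  rw [h3] at h2
  calc _ ≤ Real.exp (l ^ 2 / 8) * Real.exp (-(l ^ 2 / 8)) := by
        gcongr
        exact h2
    _ = 1 := by rw [← Real.exp_add, add_neg_cancel, Real.exp_zero]

lemma measurable_pull (hsel : Measurable sel) (t : ℕ) :
    Measurable fun ω : (ℕ → Fin K → ℝ) × (NoiseIndex K → ℝ) => hybridUCB sel ε ω.1 ω.2 t :=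
  measurable_hybridUCB hsel measurable_fst measurable_snd t

lemma measurableSet_pull (hsel : Measurable sel) (t : ℕ) (j : Fin K) :
    MeasurableSet {ω : (ℕ → Fin K → ℝ) × (NoiseIndex K → ℝ) | hybridUCB sel ε ω.1 ω.2 t = j} :=
  measurable_pull hsel t (measurableSet_singleton j)

lemma measurable_rewardDeviation (hsel : Measurable sel) (μ : ℝ) (j : Fin K) (t : ℕ) :
    Measurable fun ω : (ℕ → Fin K → ℝ) × (NoiseIndex K → ℝ) =>
      rewardDeviation (hybridUCB sel ε ω.1 ω.2) ω.1 μ j t := by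
  refine Finset.measurable_sum _ fun s _ =>
    Measurable.ite (measurableSet_pull hsel s j) ?_ measurable_const
  fun_prop

lemma measurable_pullCount (hsel : Measurable sel) (j : Fin K) (t : ℕ) :
    Measurable fun ω : (ℕ → Fin K → ℝ) × (NoiseIndex K → ℝ) =>
      pullCount (hybridUCB sel ε ω.1 ω.2) j t := by
  induction t with
  | zero => exact measurable_const
  | succ t ih =>
    simp only [pullCount_succ]
    exact ih.add (Measurable.ite (measurableSet_pull hsel t j) measurable_const measurable_const)

/-- The exponential supermartingale of the rewards of an arm. -/
noncomputable def rewardExp (sel : (Fin K → ℝ) → Fin K) (ε μ l : ℝ) (j : Fin K) (t : ℕ)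
    (ω : (ℕ → Fin K → ℝ) × (NoiseIndex K → ℝ)) : ENNReal :=
  ENNReal.ofReal (Real.exp (l * rewardDeviation (hybridUCB sel ε ω.1 ω.2) ω.1 μ j t
    - l ^ 2 / 8 * pullCount (hybridUCB sel ε ω.1 ω.2) j t))

lemma measurable_rewardExp (hsel : Measurable sel) (μ l : ℝ) (j : Fin K) (t : ℕ) :
    Measurable (rewardExp sel ε μ l j t) := by
  have h1 := measurable_rewardDeviation (ε := ε) hsel μ j t
  have h2 : Measurable fun ω : (ℕ → Fin K → ℝ) × (NoiseIndex K → ℝ) =>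
      (pullCount (hybridUCB sel ε ω.1 ω.2) j t : ℝ) :=
    (measurable_of_countable fun n : ℕ => (n : ℝ)).comp (measurable_pullCount hsel j t)
  unfold rewardExp
  fun_prop

/-- The case `s = t` matters: a decision does not see the reward of its own round. -/
lemma hybridUCB_update (x : ℕ → Fin K → ℝ) (z : NoiseIndex K → ℝ) {s t : ℕ} (hs : s ≤ t)
    (y : Fin K → ℝ) :
    hybridUCB sel ε (Function.update x t y) z s = hybridUCB sel ε x z s :=
  hybridUCB_congr z fun q hq => Function.update_of_ne (by omega) _ _

lemma rewardExp_update (μ l : ℝ) (j : Fin K) (t : ℕ) (x : ℕ → Fin K → ℝ) (y : Fin K → ℝ)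
    (z : NoiseIndex K → ℝ) :
    rewardExp sel ε μ l j t (Function.update x t y, z) = rewardExp sel ε μ l j t (x, z) := by
  have h : ∀ s < t, hybridUCB sel ε (Function.update x t y) z s = hybridUCB sel ε x z s :=
    fun s hs => hybridUCB_update x z hs.le y
  have h2 : rewardDeviation (hybridUCB sel ε (Function.update x t y) z) (Function.update x t y)
      μ j t = rewardDeviation (hybridUCB sel ε x z) x μ j t := by
    refine Finset.sum_congr rfl fun s hs => ?_
    have hs' := Finset.mem_range.1 hs
    rw [h s hs', Function.update_of_ne hs'.ne]
  simp only [rewardExp, h2, pullCount_congr h]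

lemma lintegral_rewardExp_le (hsel : Measurable sel)
    (hν : ∀ᵐ v ∂ν, ∀ j, v j ∈ Set.Icc (0 : ℝ) 1) (l : ℝ) (j : Fin K) (t : ℕ) :
    ∫⁻ ω, rewardExp sel ε (armMean ν j) l j t ω ∂(banditMeasure ν ε) ≤ 1 := by
  induction t with
  | zero => simp [rewardExp, rewardDeviation, pullCount_zero]
  | succ t ih =>
    set A : Set ((ℕ → Fin K → ℝ) × (NoiseIndex K → ℝ)) := {ω | hybridUCB sel ε ω.1 ω.2 t = j}
    have hA : MeasurableSet A := measurableSet_pull hsel t j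
    have hF := measurable_rewardExp (ε := ε) hsel (armMean ν j) l j t
    set F := rewardExp sel ε (armMean ν j) l j t
    set g : (Fin K → ℝ) → ENNReal := fun v =>
      ENNReal.ofReal (Real.exp (l * (v j - armMean ν j) - l ^ 2 / 8))
    have hg : Measurable g := by fun_prop
    -- A pull of `j` multiplies the process by `g` of the new reward vector, which is independent of
    -- the past and of mean at most `1`; otherwise the process stands still.
    have e : ∀ ω, rewardExp sel ε (armMean ν j) l j (t + 1) ω
        = A.indicator F ω * g (ω.1 t) + Aᶜ.indicator F ω := by
      intro ω
      by_cases hω : ω ∈ A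
      · rw [Set.indicator_of_mem hω, Set.indicator_of_notMem (by simpa using hω), add_zero]
        have hω' : hybridUCB sel ε ω.1 ω.2 t = j := hω
        simp only [F, g, rewardExp, ← ENNReal.ofReal_mul (Real.exp_nonneg _), ← Real.exp_add]
        rw [rewardDeviation, Finset.sum_range_succ, pullCount_succ, if_pos hω', if_pos hω',
          rewardDeviation]
        congr 2
        push_cast
        ring
      · rw [Set.indicator_of_notMem hω, Set.indicator_of_mem (by simpa using hω), zero_mul,
          zero_add]
        have hω' : ¬ hybridUCB sel ε ω.1 ω.2 t = j := hω
        simp only [F, rewardExp]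
        rw [rewardDeviation, Finset.sum_range_succ, pullCount_succ, if_neg hω', if_neg hω',
          rewardDeviation, add_zero, add_zero]
    have hupd : ∀ x y z, A.indicator F (Function.update x t y, z) = A.indicator F (x, z) := by
      intro x y z
      have h1 : (Function.update x t y, z) ∈ A ↔ (x, z) ∈ A := by
        simp only [A, Set.mem_ofPred_eq, hybridUCB_update x z le_rfl y]
      by_cases h : (x, z) ∈ A
      · rw [Set.indicator_of_mem h, Set.indicator_of_mem (h1.2 h)]
        exact rewardExp_update _ _ _ _ _ _ _
      · rw [Set.indicator_of_notMem h, Set.indicator_of_notMem (fun hh => h (h1.1 hh))]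
    simp only [e]
    rw [lintegral_add_right _ (hF.indicator hA.compl),
      lintegral_mul_eval ν (noiseMeasure K ε) t (hF.indicator hA) hg hupd]
    calc _ ≤ (∫⁻ ω, A.indicator F ω ∂(banditMeasure ν ε)) * 1
          + ∫⁻ ω, Aᶜ.indicator F ω ∂(banditMeasure ν ε) := by
          gcongr
          exact lintegral_exp_reward_le hν j l
      _ = ∫⁻ ω, F ω ∂(banditMeasure ν ε) := by
          rw [mul_one, lintegral_indicator hA, lintegral_indicator hA.compl,
            lintegral_add_compl F hA]
      _ ≤ 1 := ih

/-- Markov's inequality for the supermartingale; fixing the pull count makes its compensator a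
constant. -/
lemma exp_rewardDeviation_tail (hsel : Measurable sel)
    (hν : ∀ᵐ v ∂ν, ∀ j, v j ∈ Set.Icc (0 : ℝ) 1) (l : ℝ) (j : Fin K) (t n : ℕ) (a : ℝ) :
    (banditMeasure ν ε).real {ω | pullCount (hybridUCB sel ε ω.1 ω.2) j t = n ∧
        a ≤ l * rewardDeviation (hybridUCB sel ε ω.1 ω.2) ω.1 (armMean ν j) j t}
      ≤ Real.exp (-(a - l ^ 2 / 8 * n)) := by
  set c := Real.exp (a - l ^ 2 / 8 * n)
  have hc : 0 < c := Real.exp_pos _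
  have hsub : {ω : (ℕ → Fin K → ℝ) × (NoiseIndex K → ℝ) |
        pullCount (hybridUCB sel ε ω.1 ω.2) j t = n ∧
        a ≤ l * rewardDeviation (hybridUCB sel ε ω.1 ω.2) ω.1 (armMean ν j) j t}
      ⊆ {ω | ENNReal.ofReal c ≤ rewardExp sel ε (armMean ν j) l j t ω} := by
    rintro ω ⟨h1, h2⟩
    refine ENNReal.ofReal_le_ofReal (Real.exp_le_exp.2 ?_)
    rw [h1]
    linarith
  have hmarkov := mul_meas_ge_le_lintegral (μ := banditMeasure ν ε)
    (measurable_rewardExp (ε := ε) hsel (armMean ν j) l j t) (ENNReal.ofReal c)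
  have h1 := hmarkov.trans (lintegral_rewardExp_le hsel hν l j t)
  have h2 : c * (banditMeasure ν ε).real
      {ω | ENNReal.ofReal c ≤ rewardExp sel ε (armMean ν j) l j t ω} ≤ 1 := by
    have := ENNReal.toReal_mono ENNReal.one_ne_top h1
    rwa [ENNReal.toReal_mul, ENNReal.toReal_ofReal hc.le, ENNReal.toReal_one] at this
  rw [Real.exp_neg]
  refine (measureReal_mono hsub).trans ?_
  rwa [← one_div, le_div_iff₀' hc]

/-- Hoeffding's inequality for the rewards of an arm, whose number is fixed but which are
collected adaptively. -/
lemma rewardDeviation_tail (hsel : Measurable sel)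
    (hν : ∀ᵐ v ∂ν, ∀ j, v j ∈ Set.Icc (0 : ℝ) 1) (j : Fin K) (t : ℕ) {n : ℕ} (hn : 1 ≤ n)
    {L : ℝ} (hL : 0 ≤ L) :
    (banditMeasure ν ε).real {ω | pullCount (hybridUCB sel ε ω.1 ω.2) j t = n ∧
        n * Real.sqrt (3 * L / n)
          ≤ |rewardDeviation (hybridUCB sel ε ω.1 ω.2) ω.1 (armMean ν j) j t|}
      ≤ 2 * Real.exp (-6 * L) := by
  have hn' : (0 : ℝ) < n := by exact_mod_cast hn
  set q := Real.sqrt (3 * L / n)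
  have hq : q ^ 2 * n = 3 * L := by
    rw [Real.sq_sqrt (by positivity)]; field_simp
  have hq0 : 0 ≤ q := Real.sqrt_nonneg _
  -- `l = 4 q` maximises `l n q - l ^ 2 n / 8`, with value `2 n q ^ 2 = 6 L`.
  have hp := exp_rewardDeviation_tail (ε := ε) hsel hν (4 * q) j t n (4 * q * (n * q))
  have hm := exp_rewardDeviation_tail (ε := ε) hsel hν (-(4 * q)) j t n (4 * q * (n * q))
  have e1 : -(4 * q * (n * q) - (4 * q) ^ 2 / 8 * n) = -6 * L := by linear_combination -2 * hq
  have e2 : -(4 * q * (n * q) - (-(4 * q)) ^ 2 / 8 * n) = -6 * L := by linear_combination -2 * hq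
  rw [e1] at hp
  rw [e2] at hm
  refine (measureReal_mono ?_).trans ((measureReal_union_le _ _).trans
    ((add_le_add hp hm).trans (by linarith)))
  rintro ω ⟨h1, h2⟩
  rcases le_abs.1 h2 with h | h
  · exact Or.inl ⟨h1, mul_le_mul_of_nonneg_left h (by positivity)⟩
  · exact Or.inr ⟨h1, by
      have := mul_le_mul_of_nonneg_left h (show 0 ≤ 4 * q by positivity)
      linarith⟩

end Concentration

/-! ### How many observations make a confidence interval narrow. -/

section Width

lemma floor_logb_add_one (n : ℕ) : ⌊Real.logb 2 ((n : ℝ) + 1)⌋ = (blockIndex n : ℤ) := by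
  have h := Real.floor_logb_natCast (b := 2) (r := ((n + 1 : ℕ) : ℝ)) (by positivity)
  rw [Int.log_natCast] at h
  push_cast at h
  exact h

lemma blockIndex_le_logb (n : ℕ) : (blockIndex n : ℝ) ≤ Real.logb 2 ((n : ℝ) + 1) := by
  have := Int.floor_le (Real.logb 2 ((n : ℝ) + 1))
  rwa [floor_logb_add_one, Int.cast_natCast] at this

/-- The total width of the confidence interval of an arm with `n` observations. -/
noncomputable def confidenceWidth (ε L : ℝ) (n : ℕ) : ℝ :=
  Real.sqrt (3 * L / n) + 6 * Real.sqrt 8 * L * blockIndex n / ε / n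

lemma ucbIndex_eq {K : ℕ} {ε : ℝ} (z : NoiseIndex K → ℝ) (t : ℕ) (j : Fin K) (n : ℕ)
    (obs : ℕ → ℝ) :
    ucbIndex ε z t j n obs = privateMean z j n obs + confidenceWidth ε (Real.logb 2 t) n := by
  rw [ucbIndex, confidenceWidth, floor_logb_add_one, Int.cast_natCast, div_div, mul_comm (n : ℝ) ε,
    add_assoc]

lemma confidenceWidth_mono {ε L L' : ℝ} (hε : 0 < ε) (h : L ≤ L') (n : ℕ) :
    confidenceWidth ε L n ≤ confidenceWidth ε L' n := by
  unfold confidenceWidth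
  gcongr

/-- The inverse of `y ↦ y / log y`, up to constants. -/
lemma logb_add_one_le_of_le {A m : ℝ} (hA : 2 ≤ A) (hm : 4096 * (A * Real.logb 2 A) ≤ m) :
    68 * A * Real.logb 2 (m + 1) ≤ m := by
  set a := Real.logb 2 A
  have hA0 : 0 < A := by linarith
  have ha : 1 ≤ a := by
    rw [Real.le_logb_iff_rpow_le one_lt_two hA0, Real.rpow_one]; exact hA
  set y := m / A
  have hmy : m = A * y := by simp only [y]; field_simp
  have hy : 4096 * a ≤ y := by
    simp only [y]
    rw [le_div_iff₀ hA0]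
    linarith
  have hy0 : 0 < y := by linarith
  have hm1 : 1 ≤ m := by rw [hmy]; nlinarith
  have h1 : Real.logb 2 (m + 1) ≤ 1 + a + Real.logb 2 y := by
    have e : 1 + a + Real.logb 2 y = Real.logb 2 (2 * m) := by
      rw [hmy, Real.logb_mul two_ne_zero (by positivity), Real.logb_mul hA0.ne' hy0.ne',
        Real.logb_self_eq_one one_lt_two, add_assoc]
    rw [e]
    exact Real.logb_le_logb_of_le one_lt_two (by linarith) (by linarith)
  -- `4096 = 2 ^ 12`; after this rescaling the linear bound on the logarithm has a slope small
  -- enough to survive the factor `68`.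
  have h2 : Real.logb 2 y ≤ 12 + 2 * (y / 4096) := by
    have e : Real.logb 2 y = 12 + Real.logb 2 (y / 4096) := by
      have : Real.logb 2 4096 = 12 := by
        rw [show (4096 : ℝ) = 2 ^ (12 : ℕ) by norm_num, Real.logb_pow,
          Real.logb_self_eq_one one_lt_two]
        norm_num
      rw [Real.logb_div hy0.ne' (by norm_num), this]
      ring
    rw [e]
    gcongr
    rw [Real.logb, div_le_iff₀ (Real.log_pos one_lt_two)]
    have h3 := Real.log_le_sub_one_of_pos (show 0 < y / 4096 by positivity)
    nlinarith [Real.log_two_gt_d9, show 0 < y / 4096 by positivity]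
  rw [hmy] at h1 ⊢
  have h4 : 68 * Real.logb 2 (A * y + 1) ≤ y := by linarith
  nlinarith

/-- The leading term of the regret caused by an arm of gap `Δ`. -/
noncomputable def gapTerm (ε L Δ : ℝ) : ℝ :=
  max (L / Δ) (L / ε * Real.logb 2 (L / (ε * Δ)))

/-- Arms with enough observations have narrow confidence intervals. -/
lemma two_mul_confidenceWidth_le {ε L Δ : ℝ} (hε : 0 < ε) (hL : 1 ≤ L) (hΔ : 0 < Δ) (hΔ1 : Δ ≤ 1)
    {n : ℕ} (hn : 8192 * gapTerm ε L Δ / Δ ≤ n) : 2 * confidenceWidth ε L n ≤ Δ := by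
  rw [div_le_iff₀ hΔ] at hn
  have hW1 : L / Δ ≤ gapTerm ε L Δ := le_max_left _ _
  have hW2 : L / ε * Real.logb 2 (L / (ε * Δ)) ≤ gapTerm ε L Δ := le_max_right _ _
  have hB : 8192 * (L / Δ) ≤ n * Δ := by linarith
  have hLΔ : 1 ≤ L / Δ := by rw [le_div_iff₀ hΔ]; linarith
  have hn1 : (8192 : ℝ) ≤ n := by
    have : (n : ℝ) * Δ ≤ n := mul_le_of_le_one_right (Nat.cast_nonneg n) hΔ1
    linarith
  have hn0 : (0 : ℝ) < n := by linarith
  set A := L / (ε * Δ)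
  have hA0 : 0 < A := by positivity
  -- `68` exceeds `4 * 6 * 2.83`, the constant needed for a noise width of at most `Δ / 4`. For `A ≤
  -- 2` the logarithm of `A` may be small or negative, so `A` is replaced by `2` and `L / Δ` gives
  -- the bound; this is where `8192 = 4096 * 2` is used.
  have hlog : 68 * A * Real.logb 2 ((n : ℝ) + 1) ≤ n := by
    rcases le_total A 2 with h | h
    · have h3 := logb_add_one_le_of_le (A := 2) (m := n) le_rfl (by
        rw [Real.logb_self_eq_one one_lt_two]; linarith)
      have h4 : 0 ≤ Real.logb 2 ((n : ℝ) + 1) := Real.logb_nonneg one_lt_two (by linarith)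
      nlinarith
    · refine logb_add_one_le_of_le h ?_
      have e : A * Real.logb 2 A * Δ = L / ε * Real.logb 2 A := by
        simp only [A]; field_simp
      have ha : 0 ≤ Real.logb 2 A := Real.logb_nonneg one_lt_two (by linarith)
      have : 0 ≤ A * Real.logb 2 A * Δ := by positivity
      refine le_of_mul_le_mul_right ?_ hΔ
      nlinarith
  have hs : Real.sqrt (3 * L / n) ≤ Δ / 4 := by
    rw [Real.sqrt_le_left (by positivity), div_le_iff₀ hn0]
    have : L / Δ * Δ = L := by field_simp
    nlinarith
  have hr := blockIndex_le_logb n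
  have h8 : Real.sqrt 8 ≤ 2.83 := by
    rw [Real.sqrt_le_left (by norm_num)]; norm_num
  have ht : 6 * Real.sqrt 8 * L * blockIndex n / ε / n ≤ Δ / 4 := by
    have e : L / ε = A * Δ := by simp only [A]; field_simp
    rw [div_le_iff₀ hn0, mul_right_comm, mul_div_assoc, e]
    have hr0 : (0 : ℝ) ≤ blockIndex n := Nat.cast_nonneg _
    calc 6 * Real.sqrt 8 * blockIndex n * (A * Δ)
        ≤ 6 * 2.83 * Real.logb 2 ((n : ℝ) + 1) * (A * Δ) := by gcongr
      _ ≤ Δ / 4 * n := by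
          nlinarith [mul_le_mul_of_nonneg_right hlog hΔ.le,
            mul_nonneg (mul_nonneg hA0.le (hr0.trans hr)) hΔ.le]
  unfold confidenceWidth
  linarith

end Width

/-! ### Failure of the confidence bounds. -/

section BadEvents

variable {K : ℕ} {sel : (Fin K → ℝ) → Fin K} {ε : ℝ} {ν : Measure (Fin K → ℝ)}

/-- The rewards or the noise of arm `j` deviate too much before round `t`. -/
def badEvent (sel : (Fin K → ℝ) → Fin K) (ε : ℝ) (ν : Measure (Fin K → ℝ)) (t : ℕ) (j : Fin K) :
    Set ((ℕ → Fin K → ℝ) × (NoiseIndex K → ℝ)) :=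
  ⋃ n ∈ Finset.Icc 1 t,
    {ω | pullCount (hybridUCB sel ε ω.1 ω.2) j t = n ∧
      n * Real.sqrt (3 * Real.logb 2 (t + 1 : ℕ) / n)
        ≤ |rewardDeviation (hybridUCB sel ε ω.1 ω.2) ω.1 (armMean ν j) j t|} ∪
    {ω | 6 * Real.sqrt 8 * Real.logb 2 (t + 1 : ℕ) * blockIndex n / ε ≤ |noiseSum ω.2 j n|}

lemma exp_neg_three_mul_logb_le {m : ℕ} (hm : 1 ≤ m) :
    Real.exp (-3 * Real.logb 2 m) ≤ 1 / (m : ℝ) ^ 3 := by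
  have hm' : (1 : ℝ) ≤ m := by exact_mod_cast hm
  have h1 : Real.log m ≤ Real.logb 2 m := by
    rw [Real.logb, le_div_iff₀ (Real.log_pos one_lt_two)]
    nlinarith [Real.log_two_lt_d9, Real.log_nonneg hm']
  calc _ ≤ Real.exp (-(Real.log m + Real.log m + Real.log m)) :=
        Real.exp_le_exp.2 (by linarith)
    _ = _ := by
        rw [Real.exp_neg, Real.exp_add, Real.exp_add, Real.exp_log (by linarith), one_div]
        congr 1; ring

/-- The pull count is random and depends on the noise, hence a union over its `t` possible values,
each costing at most `4 / (t + 1) ^ 3`. -/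
lemma measureReal_badEvent_le [IsProbabilityMeasure ν] (hsel : Measurable sel) (hε : 0 < ε)
    (hν : ∀ᵐ v ∂ν, ∀ j, v j ∈ Set.Icc (0 : ℝ) 1) {t : ℕ} (ht : 1 ≤ t) (j : Fin K) :
    (banditMeasure ν ε).real (badEvent sel ε ν t j) ≤ 4 / ((t : ℝ) + 1) ^ 2 := by
  set L := Real.logb 2 (t + 1 : ℕ)
  have ht' : (1 : ℝ) ≤ t := by exact_mod_cast ht
  have hL : 1 ≤ L := by
    simp only [L]
    rw [Real.le_logb_iff_rpow_le one_lt_two (by positivity), Real.rpow_one]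
    push_cast; linarith
  have hexp := exp_neg_three_mul_logb_le (m := t + 1) (by omega)
  have hterm : ∀ n ∈ Finset.Icc 1 t, (banditMeasure ν ε).real
      ({ω | pullCount (hybridUCB sel ε ω.1 ω.2) j t = n ∧ n * Real.sqrt (3 * L / n)
        ≤ |rewardDeviation (hybridUCB sel ε ω.1 ω.2) ω.1 (armMean ν j) j t|} ∪
      {ω | 6 * Real.sqrt 8 * L * blockIndex n / ε ≤ |noiseSum ω.2 j n|})
      ≤ 4 / ((t : ℝ) + 1) ^ 3 := by
    intro n hn
    rw [Finset.mem_Icc] at hn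
    have h1 := rewardDeviation_tail (ε := ε) hsel hν j t hn.1 (zero_le_one.trans hL)
    have hnL : (blockIndex n : ℝ) ≤ L := by
      refine (blockIndex_le_logb n).trans (Real.logb_le_logb_of_le one_lt_two (by positivity) ?_)
      push_cast
      gcongr
      exact hn.2
    have h2 := noiseSum_tail hε j hn.1 hL hnL
    have h3 : (banditMeasure ν ε).real
        {ω | 6 * Real.sqrt 8 * L * blockIndex n / ε ≤ |noiseSum ω.2 j n|}
        = (noiseMeasure K ε).real
          {z | 6 * Real.sqrt 8 * L * blockIndex n / ε ≤ |noiseSum z j n|} := by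
      have hm : MeasurableSet
          {z : NoiseIndex K → ℝ | 6 * Real.sqrt 8 * L * blockIndex n / ε ≤ |noiseSum z j n|} :=
        measurableSet_le measurable_const (by fun_prop)
      exact (measurePreserving_snd (μ := Measure.infinitePi fun _ : ℕ => ν)
        (ν := noiseMeasure K ε)).measureReal_preimage hm.nullMeasurableSet
    have h4 : Real.exp (-6 * L) ≤ Real.exp (-3 * L) := Real.exp_le_exp.2 (by linarith)
    refine (measureReal_union_le _ _).trans ?_
    rw [h3]
    have h5 : 4 / ((t : ℝ) + 1) ^ 3 = 4 * (1 / ((t + 1 : ℕ) : ℝ) ^ 3) := by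
      push_cast; ring
    rw [h5]
    linarith
  refine (measureReal_biUnion_finset_le _ _).trans ((Finset.sum_le_sum hterm).trans ?_)
  rw [Finset.sum_const, Nat.card_Icc, nsmul_eq_mul, add_tsub_cancel_right]
  rw [mul_div_assoc', div_le_div_iff₀ (by positivity) (by positivity)]
  have h0 : 0 ≤ ((t : ℝ) + 1) ^ 2 := by positivity
  nlinarith

lemma abs_privateMean_sub_lt {t : ℕ} {j : Fin K}
    {ω : (ℕ → Fin K → ℝ) × (NoiseIndex K → ℝ)} (hω : ω ∉ badEvent sel ε ν t j)
    (h1 : 1 ≤ pullCount (hybridUCB sel ε ω.1 ω.2) j t) :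
    |privateMean ω.2 j (hybridState sel ε ω.1 ω.2 t j).1 (hybridState sel ε ω.1 ω.2 t j).2
        - armMean ν j|
      < confidenceWidth ε (Real.logb 2 (t + 1 : ℕ)) (hybridState sel ε ω.1 ω.2 t j).1 := by
  rw [hybridState_fst]
  set n := pullCount (hybridUCB sel ε ω.1 ω.2) j t with hn
  have hn0 : (0 : ℝ) < n := by exact_mod_cast h1
  have hmem : n ∈ Finset.Icc 1 t := Finset.mem_Icc.2 ⟨h1, pullCount_le _ _ _⟩
  simp only [badEvent, Set.mem_iUnion, not_exists] at hω
  have hb := hω n hmem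
  rw [Set.mem_union, not_or] at hb
  have hb1 : |rewardDeviation (hybridUCB sel ε ω.1 ω.2) ω.1 (armMean ν j) j t|
      < n * Real.sqrt (3 * Real.logb 2 (t + 1 : ℕ) / n) :=
    not_le.1 fun h => hb.1 ⟨hn.symm, h⟩
  have hb2 : |noiseSum ω.2 j n|
      < 6 * Real.sqrt 8 * Real.logb 2 (t + 1 : ℕ) * blockIndex n / ε := not_le.1 hb.2
  rw [privateMean_hybridState _ _ _ _ (armMean ν j) h1 hn.symm, add_sub_cancel_left, abs_div,
    abs_of_pos hn0, div_lt_iff₀ hn0, confidenceWidth]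
  refine (abs_add_le _ _).trans_lt ?_
  rw [add_mul, div_mul_cancel₀ _ hn0.ne']
  linarith

/-- Outside the bad events, the gap of a pulled arm is at most twice its confidence width. -/
lemma mean_lt_of_pull (hsel : IsArgmaxRule sel) {t : ℕ} (ht : K ≤ t) {k a : Fin K}
    {ω : (ℕ → Fin K → ℝ) × (NoiseIndex K → ℝ)} (hk : ω ∉ badEvent sel ε ν t k)
    (ha : ω ∉ badEvent sel ε ν t a) (hpull : hybridUCB sel ε ω.1 ω.2 t = k) :
    armMean ν a - armMean ν k < 2 * confidenceWidth ε (Real.logb 2 (t + 1 : ℕ))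
      (pullCount (hybridUCB sel ε ω.1 ω.2) k t) := by
  have h1 := abs_lt.1 (abs_privateMean_sub_lt hk (one_le_pullCount _ _ ht k))
  have h2 := abs_lt.1 (abs_privateMean_sub_lt ha (one_le_pullCount _ _ ht a))
  have hmax := hsel.2 (fun j => ucbIndex ε ω.2 (t + 1) j (hybridState sel ε ω.1 ω.2 t j).1
    (hybridState sel ε ω.1 ω.2 t j).2) a
  rw [hybridUCB, pullArm, dif_neg (not_lt.2 ht)] at hpull
  rw [hpull] at hmax
  simp only [ucbIndex_eq] at hmax
  rw [← hybridState_fst]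
  linarith [h1.1, h1.2, h2.1, h2.2]

end BadEvents

/-! ### Counting pulls, bounds on the gaps and a summable series. -/

section Regret

variable {K : ℕ} {sel : (Fin K → ℝ) → Fin K} {ε : ℝ} {ν : Measure (Fin K → ℝ)}

/-- At most `m` pulls have fewer than `m` predecessors. -/
lemma pullCount_le_add (J : ℕ → Fin K) (k : Fin K) (m T : ℕ) :
    pullCount J k T ≤ m
      + ∑ t ∈ Finset.range T, if J t = k ∧ m ≤ pullCount J k t then 1 else 0 := by
  induction T with
  | zero => simp [pullCount_zero]
  | succ T ih =>
    rw [pullCount_succ, Finset.sum_range_succ]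
    by_cases h1 : J T = k
    · by_cases h2 : m ≤ pullCount J k T
      · rw [if_pos h1, if_pos ⟨h1, h2⟩]; omega
      · rw [if_pos h1, if_neg fun h => h2 h.2]; omega
    · rw [if_neg h1, if_neg fun h => h1 h.1]; omega

lemma armMean_le_iSup (j : Fin K) : armMean ν j ≤ ⨆ k, armMean ν k :=
  le_ciSup (Set.finite_range _).bddAbove j

lemma armGap_nonneg (j : Fin K) : 0 ≤ armGap ν j := sub_nonneg.2 (armMean_le_iSup j)

variable [IsProbabilityMeasure ν]

lemma armMean_mem_Icc (hν : ∀ᵐ v ∂ν, ∀ j, v j ∈ Set.Icc (0 : ℝ) 1) (j : Fin K) :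
    armMean ν j ∈ Set.Icc (0 : ℝ) 1 := by
  refine ⟨integral_nonneg_of_ae (hν.mono fun v hv => (hv j).1), ?_⟩
  have hm : AEMeasurable (fun v : Fin K → ℝ => v j) ν := (measurable_pi_apply j).aemeasurable
  have h := integral_mono_ae (Integrable.of_mem_Icc 0 1 hm (hν.mono fun v hv => hv j))
    (integrable_const (1 : ℝ)) (hν.mono fun v hv => (hv j).2)
  simpa [armMean] using h

lemma armGap_le_one (hν : ∀ᵐ v ∂ν, ∀ j, v j ∈ Set.Icc (0 : ℝ) 1) (j : Fin K) :
    armGap ν j ≤ 1 := by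
  have : Nonempty (Fin K) := ⟨j⟩
  have h1 : ⨆ k, armMean ν k ≤ 1 := ciSup_le fun k => (armMean_mem_Icc hν k).2
  have h2 := (armMean_mem_Icc hν j).1
  unfold armGap
  linarith

lemma sum_inv_sq_le (T : ℕ) : ∑ t ∈ Finset.range T, 1 / ((t : ℝ) + 1) ^ 2 ≤ 2 := by
  -- The strengthened bound makes the induction telescope. At `T = 0` the fraction `1 / T` is `0` by
  -- convention, so the step to `1` is separate.
  suffices h : ∑ t ∈ Finset.range T, 1 / ((t : ℝ) + 1) ^ 2 ≤ 2 - 1 / (T : ℝ) by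
    have : 0 ≤ 1 / (T : ℝ) := by positivity
    linarith
  induction T with
  | zero => simp
  | succ T ih =>
    rw [Finset.sum_range_succ]
    rcases T.eq_zero_or_pos with rfl | hT
    · norm_num
    · have hT' : (0 : ℝ) < T := by exact_mod_cast hT
      have h : 1 / ((T : ℝ) + 1) ^ 2 ≤ 1 / (T * (T + 1)) :=
        one_div_le_one_div_of_le (by positivity) (by nlinarith)
      have e : 1 / ((T : ℝ) * (T + 1)) = 1 / T - 1 / (T + 1) := by field_simp; ring
      push_cast
      linarith

end Regret

/-! ### Expected pulls and the regret decomposition. -/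

section Regret

variable {K : ℕ} {sel : (Fin K → ℝ) → Fin K} {ε : ℝ} {ν : Measure (Fin K → ℝ)}
  [IsProbabilityMeasure ν]

lemma pullCount_eq_zero_of_lt (x : ℕ → Fin K → ℝ) (z : NoiseIndex K → ℝ) {t : ℕ} (ht : t < K)
    {k : Fin K} (hk : hybridUCB sel ε x z t = k) : pullCount (hybridUCB sel ε x z) k t = 0 := by
  refine Finset.card_eq_zero.2 (Finset.filter_eq_empty_iff.2 fun s hs h => ?_)
  rw [Finset.mem_range] at hs
  rw [← hk] at h
  simp only [hybridUCB, pullArm, ht, hs.trans ht, dif_pos, Fin.mk.injEq] at h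
  omega

lemma one_le_logb_two {T : ℕ} (hT : 2 ≤ T) : 1 ≤ Real.logb 2 T := by
  have : (2 : ℝ) ≤ T := by exact_mod_cast hT
  rw [Real.le_logb_iff_rpow_le one_lt_two (by linarith), Real.rpow_one]
  exact this

/-- After `m` pulls the confidence width is too small for the gap, so a further pull forces a bad
event for `k` or for an optimal arm. In the initial rounds no arm is repeated, so `m ≥ 1` excludes
them. -/
lemma measureReal_late_pull_le (hsel : IsArgmaxRule sel) (hε : 0 < ε)
    (hν : ∀ᵐ v ∂ν, ∀ j, v j ∈ Set.Icc (0 : ℝ) 1) {T : ℕ} (hT : 2 ≤ T) {k : Fin K}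
    (hk : 0 < armGap ν k) {m : ℕ} (hm1 : 1 ≤ m)
    (hm : 8192 * gapTerm ε (Real.logb 2 T) (armGap ν k) / armGap ν k ≤ m) {t : ℕ} (ht : t < T) :
    (banditMeasure ν ε).real {ω | hybridUCB sel ε ω.1 ω.2 t = k ∧
        m ≤ pullCount (hybridUCB sel ε ω.1 ω.2) k t} ≤ 8 / ((t : ℝ) + 1) ^ 2 := by
  rcases lt_or_ge t K with htK | htK
  · have e : {ω : (ℕ → Fin K → ℝ) × (NoiseIndex K → ℝ) | hybridUCB sel ε ω.1 ω.2 t = k ∧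
        m ≤ pullCount (hybridUCB sel ε ω.1 ω.2) k t} = ∅ := by
      refine Set.eq_empty_iff_forall_notMem.2 fun ω hω => ?_
      have h1 := pullCount_eq_zero_of_lt ω.1 ω.2 htK hω.1
      have h2 : m ≤ pullCount (hybridUCB sel ε ω.1 ω.2) k t := hω.2
      omega
    rw [e, measureReal_empty]
    positivity
  · have ht1 : 1 ≤ t := by have := k.2; omega
    have : Nonempty (Fin K) := ⟨k⟩
    obtain ⟨a, ha⟩ := exists_eq_ciSup_of_finite (f := armMean ν)
    have hsub : {ω : (ℕ → Fin K → ℝ) × (NoiseIndex K → ℝ) | hybridUCB sel ε ω.1 ω.2 t = k ∧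
        m ≤ pullCount (hybridUCB sel ε ω.1 ω.2) k t}
        ⊆ badEvent sel ε ν t k ∪ badEvent sel ε ν t a := by
      rintro ω ⟨h1, h2⟩
      by_contra hω
      rw [Set.mem_union, not_or] at hω
      have h3 := mean_lt_of_pull hsel htK hω.1 hω.2 h1
      have h4 : Real.logb 2 (t + 1 : ℕ) ≤ Real.logb 2 T :=
        Real.logb_le_logb_of_le one_lt_two (by positivity) (by exact_mod_cast ht)
      have h5 := confidenceWidth_mono hε h4 (pullCount (hybridUCB sel ε ω.1 ω.2) k t)
      have h6 := two_mul_confidenceWidth_le hε (one_le_logb_two hT) hk (armGap_le_one hν k)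
        (hm.trans (Nat.cast_le.2 h2))
      rw [ha] at h3
      change armGap ν k < _ at h3
      linarith
    have hb := fun j => measureReal_badEvent_le (sel := sel) hsel.1 hε hν ht1 j
    refine (measureReal_mono hsub).trans ((measureReal_union_le _ _).trans
      ((add_le_add (hb k) (hb a)).trans (le_of_eq ?_)))
    ring

lemma measurableSet_late_pull (hsel : Measurable sel) (k : Fin K) (m t : ℕ) :
    MeasurableSet {ω : (ℕ → Fin K → ℝ) × (NoiseIndex K → ℝ) | hybridUCB sel ε ω.1 ω.2 t = k ∧
      m ≤ pullCount (hybridUCB sel ε ω.1 ω.2) k t} :=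
  (measurableSet_pull hsel t k).inter
    (measurableSet_le measurable_const (measurable_pullCount hsel k t))

/-- The expected number of pulls, split according to the number of earlier pulls. -/
lemma sum_measureReal_pull_le (hsel : Measurable sel) (k : Fin K) (m T : ℕ) :
    ∑ t ∈ Finset.range T, (banditMeasure ν ε).real {ω | hybridUCB sel ε ω.1 ω.2 t = k}
      ≤ m + ∑ t ∈ Finset.range T, (banditMeasure ν ε).real {ω | hybridUCB sel ε ω.1 ω.2 t = k ∧
        m ≤ pullCount (hybridUCB sel ε ω.1 ω.2) k t} := by
  set Q := banditMeasure ν ε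
  set A : ℕ → Set ((ℕ → Fin K → ℝ) × (NoiseIndex K → ℝ)) := fun t =>
    {ω | hybridUCB sel ε ω.1 ω.2 t = k}
  set B : ℕ → Set ((ℕ → Fin K → ℝ) × (NoiseIndex K → ℝ)) := fun t =>
    {ω | hybridUCB sel ε ω.1 ω.2 t = k ∧ m ≤ pullCount (hybridUCB sel ε ω.1 ω.2) k t}
  have hA : ∀ t, MeasurableSet (A t) := fun t => measurableSet_pull hsel t k
  have hB : ∀ t, MeasurableSet (B t) := fun t => measurableSet_late_pull hsel k m t
  have iA : ∀ t, Integrable ((A t).indicator (fun _ => (1 : ℝ))) Q := fun t =>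
    (integrable_const (1 : ℝ)).indicator (hA t)
  have iB : ∀ t, Integrable ((B t).indicator (fun _ => (1 : ℝ))) Q := fun t =>
    (integrable_const (1 : ℝ)).indicator (hB t)
  have eA : ∑ t ∈ Finset.range T, Q.real (A t)
      = ∫ ω, ∑ t ∈ Finset.range T, (A t).indicator (fun _ => (1 : ℝ)) ω ∂Q := by
    rw [integral_finsetSum _ fun t _ => iA t]
    exact Finset.sum_congr rfl fun t _ => (integral_indicator_one (hA t)).symm
  have eB : m + ∑ t ∈ Finset.range T, Q.real (B t)
      = ∫ ω, (m + ∑ t ∈ Finset.range T, (B t).indicator (fun _ => (1 : ℝ)) ω) ∂Q := by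
    rw [integral_add (integrable_const _) (integrable_finsetSum _ fun t _ => iB t),
      integral_finsetSum _ fun t _ => iB t, integral_const, probReal_univ, one_smul]
    congr 1
    exact Finset.sum_congr rfl fun t _ => (integral_indicator_one (hB t)).symm
  change ∑ t ∈ Finset.range T, Q.real (A t) ≤ m + ∑ t ∈ Finset.range T, Q.real (B t)
  rw [eA, eB]
  refine integral_mono (integrable_finsetSum _ fun t _ => iA t)
    ((integrable_const _).add (integrable_finsetSum _ fun t _ => iB t)) fun ω => ?_
  have h := pullCount_le_add (hybridUCB sel ε ω.1 ω.2) k m T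
  rw [pullCount, Finset.card_filter] at h
  have h' := (Nat.cast_le (α := ℝ)).2 h
  push_cast at h'
  convert h' using 2
  · exact Set.indicator_apply _ _ _
  · congr 1
    funext t
    exact Set.indicator_apply _ _ _

lemma expected_pulls_le (hsel : IsArgmaxRule sel) (hε : 0 < ε)
    (hν : ∀ᵐ v ∂ν, ∀ j, v j ∈ Set.Icc (0 : ℝ) 1) {T : ℕ} (hT : 2 ≤ T) {k : Fin K}
    (hk : 0 < armGap ν k) :
    armGap ν k * ∑ t ∈ Finset.range T, (banditMeasure ν ε).real
        {ω | hybridUCB sel ε ω.1 ω.2 t = k}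
      ≤ 10000 * gapTerm ε (Real.logb 2 T) (armGap ν k) := by
  set W := gapTerm ε (Real.logb 2 T) (armGap ν k)
  set Δ := armGap ν k
  have hΔ1 : Δ ≤ 1 := armGap_le_one hν k
  have hL := one_le_logb_two hT
  have hW : 1 ≤ W := by
    refine le_trans ?_ (le_max_left _ _)
    rw [le_div_iff₀ hk]; linarith
  have hpos : 0 < 8192 * W / Δ := by positivity
  set m := ⌈8192 * W / Δ⌉₊
  have hm1 : 1 ≤ m := Nat.one_le_iff_ne_zero.2 (Nat.ceil_pos.2 hpos).ne'
  have hm2 : (m : ℝ) < 8192 * W / Δ + 1 := Nat.ceil_lt_add_one hpos.le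
  have h1 := sum_measureReal_pull_le (ε := ε) (ν := ν) hsel.1 k m T
  have h2 : ∑ t ∈ Finset.range T, (banditMeasure ν ε).real {ω | hybridUCB sel ε ω.1 ω.2 t = k ∧
        m ≤ pullCount (hybridUCB sel ε ω.1 ω.2) k t} ≤ 16 := by
    calc _ ≤ ∑ t ∈ Finset.range T, 8 * (1 / ((t : ℝ) + 1) ^ 2) :=
          Finset.sum_le_sum fun t ht => by
            rw [mul_one_div]
            exact measureReal_late_pull_le hsel hε hν hT hk hm1 (Nat.le_ceil _)
              (Finset.mem_range.1 ht)
      _ ≤ 16 := by rw [← Finset.mul_sum]; linarith [sum_inv_sq_le T]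
  -- `17` is `16` for late pulls plus `1` for rounding up; `Δ ≤ 1 ≤ W` absorbs it.
  calc _ ≤ Δ * (8192 * W / Δ + 17) := by gcongr; linarith
    _ = 8192 * W + 17 * Δ := by field_simp
    _ ≤ 10000 * W := by linarith

lemma ae_reward_mem (hν : ∀ᵐ v ∂ν, ∀ j, v j ∈ Set.Icc (0 : ℝ) 1) (ε : ℝ) (t : ℕ) :
    ∀ᵐ ω ∂(banditMeasure ν ε), ∀ j, ω.1 t j ∈ Set.Icc (0 : ℝ) 1 := by
  have h1 : MeasurePreserving (fun ω : (ℕ → Fin K → ℝ) × (NoiseIndex K → ℝ) => ω.1 t)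
      (banditMeasure ν ε) ν :=
    (measurePreserving_eval_infinitePi (fun _ : ℕ => ν) t).comp measurePreserving_fst
  exact h1.quasiMeasurePreserving.ae hν

lemma integrable_reward (hν : ∀ᵐ v ∂ν, ∀ j, v j ∈ Set.Icc (0 : ℝ) 1) (ε : ℝ) (t : ℕ) (j : Fin K) :
    Integrable (fun ω : (ℕ → Fin K → ℝ) × (NoiseIndex K → ℝ) => ω.1 t j) (banditMeasure ν ε) :=
  Integrable.of_mem_Icc 0 1 (by fun_prop) ((ae_reward_mem hν ε t).mono fun _ h => h j)

lemma integral_reward (t : ℕ) (j : Fin K) :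
    ∫ ω, ω.1 t j ∂(banditMeasure ν ε) = armMean ν j := by
  have h1 : MeasurePreserving (fun ω : (ℕ → Fin K → ℝ) × (NoiseIndex K → ℝ) => ω.1 t)
      (banditMeasure ν ε) ν :=
    (measurePreserving_eval_infinitePi (fun _ : ℕ => ν) t).comp measurePreserving_fst
  have h2 := integral_map (μ := banditMeasure ν ε) h1.measurable.aemeasurable
    (f := fun v : Fin K → ℝ => v j) (measurable_pi_apply j).aestronglyMeasurable
  rw [h1.map_eq] at h2
  exact h2.symm

/-- The reward of a round is independent of the decision in this round. -/
lemma integral_indicator_reward (hsel : Measurable sel)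
    (hν : ∀ᵐ v ∂ν, ∀ j, v j ∈ Set.Icc (0 : ℝ) 1) (t : ℕ) (k : Fin K) :
    ∫ ω, {ω : (ℕ → Fin K → ℝ) × (NoiseIndex K → ℝ) | hybridUCB sel ε ω.1 ω.2 t = k}.indicator
        (fun ω => ω.1 t k) ω ∂(banditMeasure ν ε)
      = (banditMeasure ν ε).real {ω | hybridUCB sel ε ω.1 ω.2 t = k} * armMean ν k := by
  set A : Set ((ℕ → Fin K → ℝ) × (NoiseIndex K → ℝ)) := {ω | hybridUCB sel ε ω.1 ω.2 t = k}
  have hA : MeasurableSet A := measurableSet_pull hsel t k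
  have hpos : 0 ≤ᵐ[banditMeasure ν ε] A.indicator (fun ω => ω.1 t k) := by
    filter_upwards [ae_reward_mem hν ε t] with ω hω
    exact Set.indicator_apply_nonneg fun _ => (hω k).1
  have hm : Measurable fun ω : (ℕ → Fin K → ℝ) × (NoiseIndex K → ℝ) => ω.1 t k := by fun_prop
  rw [integral_eq_lintegral_of_nonneg_ae hpos (hm.indicator hA).aestronglyMeasurable]
  have e : ∀ ω, ENNReal.ofReal (A.indicator (fun ω => ω.1 t k) ω)
      = A.indicator 1 ω * ENNReal.ofReal (ω.1 t k) := by
    intro ω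
    by_cases h : ω ∈ A <;> simp [h]
  have hupd : ∀ x y z, A.indicator (fun _ => (1 : ENNReal)) (Function.update x t y, z)
      = A.indicator 1 (x, z) := by
    intro x y z
    have h1 : (Function.update x t y, z) ∈ A ↔ (x, z) ∈ A := by
      simp only [A, Set.mem_ofPred_eq, hybridUCB_update x z le_rfl y]
    by_cases h : (x, z) ∈ A <;> simp [h1, h]
  have hl := lintegral_mul_eval ν (noiseMeasure K ε) t (measurable_one.indicator hA)
    (g := fun v => ENNReal.ofReal (v k)) (by fun_prop) hupd
  have hmean : armMean ν k = (∫⁻ v, ENNReal.ofReal (v k) ∂ν).toReal :=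
    integral_eq_lintegral_of_nonneg_ae (hν.mono fun v hv => (hv k).1)
      (measurable_pi_apply k).aestronglyMeasurable
  simp only [e]
  rw [hl, lintegral_indicator_one hA, ENNReal.toReal_mul, hmean]
  rfl

lemma sum_indicator_reward (ω : (ℕ → Fin K → ℝ) × (NoiseIndex K → ℝ)) (t : ℕ) :
    ω.1 t (hybridUCB sel ε ω.1 ω.2 t) = ∑ k, {ω : (ℕ → Fin K → ℝ) × (NoiseIndex K → ℝ) |
      hybridUCB sel ε ω.1 ω.2 t = k}.indicator (fun ω => ω.1 t k) ω := by
  simp [Set.indicator_apply]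

lemma sum_measureReal_pull (hsel : Measurable sel) (t : ℕ) :
    ∑ k, (banditMeasure ν ε).real {ω | hybridUCB sel ε ω.1 ω.2 t = k} = 1 := by
  have h := measureReal_biUnion_finset (μ := banditMeasure ν ε) (s := Finset.univ)
    (f := fun k : Fin K => {ω | hybridUCB sel ε ω.1 ω.2 t = k})
    (fun a _ b _ hab => Set.disjoint_left.2 fun ω h1 h2 => hab (Eq.trans (Eq.symm h1) h2))
    (fun k _ => measurableSet_pull hsel t k)
  rw [← h]
  have : (⋃ k ∈ Finset.univ, {ω : (ℕ → Fin K → ℝ) × (NoiseIndex K → ℝ) |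
      hybridUCB sel ε ω.1 ω.2 t = k}) = Set.univ := by ext; simp
  rw [this, probReal_univ]

/-- The regret with respect to arm `j` in terms of the pulls. -/
lemma integral_regret_le (hsel : Measurable sel)
    (hν : ∀ᵐ v ∂ν, ∀ j, v j ∈ Set.Icc (0 : ℝ) 1) (T : ℕ) (j : Fin K) :
    ∫ ω, (∑ t ∈ Finset.range T, ω.1 t j
        - ∑ t ∈ Finset.range T, ω.1 t (hybridUCB sel ε ω.1 ω.2 t)) ∂(banditMeasure ν ε)
      ≤ ∑ k, armGap ν k * ∑ t ∈ Finset.range T,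
        (banditMeasure ν ε).real {ω | hybridUCB sel ε ω.1 ω.2 t = k} := by
  simp only [sum_indicator_reward]
  have iR : ∀ t k, Integrable ({ω : (ℕ → Fin K → ℝ) × (NoiseIndex K → ℝ) |
      hybridUCB sel ε ω.1 ω.2 t = k}.indicator fun ω => ω.1 t k) (banditMeasure ν ε) :=
    fun t k => (integrable_reward hν ε t k).indicator (measurableSet_pull hsel t k)
  rw [integral_sub (integrable_finsetSum _ fun t _ => integrable_reward hν ε t j)
      (integrable_finsetSum _ fun t _ => integrable_finsetSum _ fun k _ => iR t k),
    integral_finsetSum _ fun t _ => integrable_reward hν ε t j,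
    integral_finsetSum _ fun t _ => integrable_finsetSum _ fun k _ => iR t k,
    ← Finset.sum_sub_distrib]
  simp only [Finset.mul_sum]
  rw [Finset.sum_comm]
  refine Finset.sum_le_sum fun t _ => ?_
  rw [integral_reward, integral_finsetSum _ fun k _ => iR t k]
  simp only [integral_indicator_reward hsel hν]
  have h1 := sum_measureReal_pull (ε := ε) (ν := ν) hsel t
  -- The pull probabilities of a round sum to `1`, so the maximal mean can be distributed over the
  -- arms, turning differences of means into gaps.
  have h2 : armMean ν j ≤ ∑ k, (⨆ a, armMean ν a) * (banditMeasure ν ε).real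
      {ω | hybridUCB sel ε ω.1 ω.2 t = k} := by
    rw [← Finset.mul_sum, h1, mul_one]
    exact armMean_le_iSup j
  simp only [armGap, sub_mul, Finset.sum_sub_distrib]
  refine sub_le_sub h2 (le_of_eq (Finset.sum_congr rfl fun k _ => mul_comm _ _))

theorem pseudoRegret_hybridUCB_le (hK : 1 ≤ K) (hsel : IsArgmaxRule sel) (hε : 0 < ε)
    (hν : ∀ᵐ v ∂ν, ∀ j, v j ∈ Set.Icc (0 : ℝ) 1) {T : ℕ} (hT : 2 ≤ T) :
    pseudoRegret (noiseMeasure K ε) (hybridUCB sel ε) ν T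
      ≤ 10000 * ∑ j : Fin K with 0 < armGap ν j, gapTerm ε (Real.logb 2 T) (armGap ν j) := by
  have : Nonempty (Fin K) := ⟨⟨0, hK⟩⟩
  refine ciSup_le fun j => (integral_regret_le hsel.1 hν T j).trans ?_
  rw [Finset.mul_sum, Finset.sum_filter]
  refine Finset.sum_le_sum fun k _ => ?_
  split_ifs with hk
  · exact expected_pulls_le hsel hε hν hT hk
  · rw [le_antisymm (not_lt.1 hk) (armGap_nonneg k), zero_mul]

end Regret

theorem theorem4 :
    (∀ (K : ℕ) (sel : (Fin K → ℝ) → Fin K) (ε : ℝ) (T : ℕ),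
      1 ≤ K → IsArgmaxRule sel → 0 < ε →
        IsDifferentiallyPrivate (noiseMeasure K ε) (hybridUCB sel ε) ε T) ∧
    ∃ C : ℝ, 0 < C ∧
      ∀ (K : ℕ) (sel : (Fin K → ℝ) → Fin K) (ε : ℝ) (T : ℕ)
        (ν : Measure (Fin K → ℝ)) [IsProbabilityMeasure ν],
        1 ≤ K → IsArgmaxRule sel → 0 < ε → 2 ≤ T →
        (∀ᵐ v ∂ν, ∀ j, v j ∈ Set.Icc (0 : ℝ) 1) →
        pseudoRegret (noiseMeasure K ε) (hybridUCB sel ε) ν T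
          ≤ C * ∑ j : Fin K with 0 < armGap ν j,
              max (Real.logb 2 T / armGap ν j)
                (Real.logb 2 T / ε * Real.logb 2 (Real.logb 2 T / (ε * armGap ν j))) :=
  ⟨fun _ _ _ T _ hsel hε => isDifferentiallyPrivate_hybridUCB hsel.1 hε T,
    10000, by norm_num, fun _ _ _ _ _ _ hK hsel hε hT hν =>
      pseudoRegret_hybridUCB_le hK hsel hε hν hT⟩
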